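/- A length function on a group $G$ is a map $l:G\to[0,\infty)$ with $l(e)=0$, $l(g^{-1})=l(g)$ and $l(gh)\le l(g)+l(h)$. For $f:\mathbb N\to\mathbb R$ we say that $(G,l)$ has $f$-decay if $\|x\|\le f(n)\,\|x\|_2$ for every $n\in\mathbb N$ and every $x\in\mathbb C[G]$ supported on $\{g: l(g)\le n\}$, where $\|x\|$ is the norm of $x$ acting on $\ell^2(G)$ through the left regular representation and $\|x\|_2=(\sum_g|x(g)|^2)^{1/2}$. $(G,l)$ has RD if it has $f$-decay for some polynomial $f$, and SD if it has $f$-decay for some $f:\mathbb N\to[0,\infty)$ with $\lim_n f(n)^{1/n}=1$. Let $G$ and $H$ be groups with a common subgroup $A$, and let $\Gamma=G*_AH$ be the amalgamated free product. (1) Let $L_G:G\to\mathbb N$ and $L_H:H\to\mathbb N$ be integer-valued length functions that agree on $A$, and suppose $L_G(g)\ge1$ for $g\in G\setminus A$ and $L_H(h)\ge 1$ for $h\in H\setminus A$. For $k\in\Gamma$ let $L(k)$ be the minimum of $L_G(a)+\ell(s_1)+\dots+\ell(s_m)$ over all ways of writing $k=a s_1\cdots s_m$ with $m\ge0$, $a\in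 A$, and letters $s_r$ taken alternately from $G\setminus A$ and $H\setminus A$ (starting with either), where $\ell=L_G$ on $G\setminus A$ and $\ell=L_H$ on $H\setminus A$. Then $L$ is a length function on $\Gamma$; if $(G,L_G)$ and $(H,L_H)$ have RD (resp. SD), then $(\Gamma,L)$ has RD (resp. SD); and if $(G,L_G)$ and $(H,L_H)$ both have $f$-decay for some $f:\mathbb N\to\mathbb R$, then $(\Gamma,L)$ has $\tilde f$-decay with $\tilde f(n)=(2n+1)^{7/2}f(2n)$. (2) Let $L_G$ and $L_H$ be arbitrary length functions on $G$ and $H$ (with values in $[0,\infty)$) that agree on $A$. If $(G,L_G)$ and $(H,L_H)$ have RD (resp. SD), then there is a length function on $\Gamma$ with respect to which $\Gamma$ has RD (resp. SD). -/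

import Mathlib

open Filter Topology

universe u v

noncomputable section

/-- A length function on a group, with values in `[0, ∞)`. -/
structure IsLengthFunction {G : Type u} [Group G] (l : G → ℝ) : Prop where
  nonneg : ∀ g, 0 ≤ l g
  map_one : l 1 = 0
  map_inv : ∀ g, l g⁻¹ = l g
  map_mul_le : ∀ g h, l (g * h) ≤ l g + l h

/-- The Hilbert space `ℓ²(G)`. -/
abbrev EllTwo (G : Type u) : Type u := lp (fun _ : G => ℂ) 2

theorem memℓp_translate {G : Type u} [Group G] (g : G) (ξ : EllTwo G) :
    Memℓp (fun h : G => ξ (g⁻¹ * h)) 2 := by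
  have hp : 0 < (2 : ENNReal).toReal := by norm_num
  have h := (memℓp_gen_iff hp).1 (lp.memℓp ξ)
  exact (memℓp_gen_iff hp).2 ((Equiv.mulLeft g⁻¹).summable_iff.2 h)

/-- The unitary `λ(g)` of the left regular representation: `(λ(g) ξ)(h) = ξ(g⁻¹ h)`. -/
def leftTranslate {G : Type u} [Group G] (g : G) : EllTwo G →ₗᵢ[ℂ] EllTwo G where
  toFun ξ := ⟨fun h => ξ (g⁻¹ * h), memℓp_translate g ξ⟩
  map_add' _ _ := rfl
  map_smul' _ _ := rfl
  norm_map' ξ := by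
    have hp : 0 < (2 : ENNReal).toReal := by norm_num
    rw [lp.norm_eq_tsum_rpow hp, lp.norm_eq_tsum_rpow hp]
    congr 1
    exact (Equiv.mulLeft g⁻¹).tsum_eq (fun h => ‖ξ h‖ ^ (2 : ENNReal).toReal)

theorem leftTranslate_apply {G : Type u} [Group G] (g : G) (ξ : EllTwo G) (h : G) :
    leftTranslate g ξ h = ξ (g⁻¹ * h) := rfl

/-- The left regular representation of `G` on `ℓ²(G)`. -/
def leftRegular (G : Type u) [Group G] : G →* (EllTwo G →L[ℂ] EllTwo G) where
  toFun g := (leftTranslate g).toContinuousLinearMap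
  map_one' := by
    ext ξ h
    simp [leftTranslate_apply]
  map_mul' a b := by
    ext ξ h
    simp [leftTranslate_apply, mul_assoc]

/-- The norm of an element of `ℂ[G]` as an operator on `ℓ²(G)`, through the linear extension of
the left regular representation. -/
def reducedNorm {G : Type u} [Group G] (x : MonoidAlgebra ℂ G) : ℝ :=
  ‖MonoidAlgebra.lift ℂ (EllTwo G →L[ℂ] EllTwo G) G (leftRegular G) x‖

/-- The `2`-norm of an element of `ℂ[G]`. -/
def twoNorm {G : Type u} [Group G] (x : MonoidAlgebra ℂ G) : ℝ :=
  Real.sqrt (∑ g ∈ x.coeff.support, ‖x.coeff g‖ ^ 2)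

/-- `(G, l)` has `f`-decay. -/
def HasDecay {G : Type u} [Group G] (l : G → ℝ) (f : ℕ → ℝ) : Prop :=
  ∀ (n : ℕ) (x : MonoidAlgebra ℂ G), (∀ g ∈ x.coeff.support, l g ≤ n) →
    reducedNorm x ≤ f n * twoNorm x

/-- A function `f : ℕ → [0, ∞)` with `f(n)^(1/n) → 1`. -/
def IsSubexponential (f : ℕ → ℝ) : Prop :=
  (∀ n, 0 ≤ f n) ∧ Tendsto (fun n : ℕ => f n ^ (1 / (n : ℝ))) atTop (𝓝 1)

/-- Rapid decay with respect to `l`. -/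
def HasRD {G : Type u} [Group G] (l : G → ℝ) : Prop :=
  ∃ P : Polynomial ℝ, HasDecay l (fun n => P.eval (n : ℝ))

/-- Subexponential decay with respect to `l`. -/
def HasSD {G : Type u} [Group G] (l : G → ℝ) : Prop :=
  ∃ f : ℕ → ℝ, IsSubexponential f ∧ HasDecay l f

/-- The two factors `G`, `H` as a family. -/
def Factor (G H : Type u) : Bool → Type u
  | false => G
  | true => H

instance Factor.instGroup (G H : Type u) [Group G] [Group H] : ∀ b, Group (Factor G H b)
  | false => inferInstanceAs (Group G)
  | true => inferInstanceAs (Group H)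

/-- The two inclusions of the common subgroup `A`. -/
def factorMap {A : Type v} {G H : Type u} [Group A] [Group G] [Group H]
    (i : A →* G) (j : A →* H) : ∀ b, A →* Factor G H b
  | false => i
  | true => j

/-- The amalgamated free product `G *_A H`, the pushout of `i : A → G` and `j : A → H`. -/
abbrev Amalgam {A : Type v} {G H : Type u} [Group A] [Group G] [Group H]
    (i : A →* G) (j : A →* H) : Type (max u v) :=
  Monoid.PushoutI (factorMap i j)

/-- The length of a letter: `L_G` on letters from `G`, `L_H` on letters from `H`. -/
def letterLength {G H : Type u} (LG : G → ℕ) (LH : H → ℕ) : (Σ b, Factor G H b) → ℕ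
  | ⟨false, g⟩ => LG g
  | ⟨true, h⟩ => LH h

/-- The length on `G *_A H`: the minimum of `L_A(a) + L(s₁) + ⋯ + L(sₘ)` over all ways to write
`k = a s₁ ⋯ sₘ` with `a ∈ A` and letters `sᵢ` taken alternately from `G \ A` and `H \ A`.
Here `L_A` is the restriction of `LG` to `A`. -/
def amalgamLength {A : Type v} {G H : Type u} [Group A] [Group G] [Group H]
    (i : A →* G) (j : A →* H) (LG : G → ℕ) (LH : H → ℕ) (k : Amalgam i j) : ℕ :=
  sInf {n : ℕ | ∃ (a : A) (w : Monoid.CoprodI.Word (Factor G H)),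
    Monoid.PushoutI.Reduced (factorMap i j) w ∧
    Monoid.PushoutI.base (factorMap i j) a * Monoid.PushoutI.ofCoprodI w.prod = k ∧
    n = LG (i a) + (w.toList.map (letterLength LG LH)).sum}

end

/-!
Decay at radius `n` is a bound `⟨φ * ψ, χ⟩ ≤ c ‖φ‖₂ ‖ψ‖₂ ‖χ‖₂` on the trilinear form
`∑ φ(g) ψ(h) χ(gh)` for nonnegative `φ` supported in the ball of radius `n`. By the Cauchy–Schwarz
inequality `∑ α(u, v) β(v, w) γ(u, w) ≤ ‖α‖₂ ‖β‖₂ ‖γ‖₂`, such a bound with constant `c` persists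
when the entries of the three functions are indexed by pairs of points of a set as well.

In an amalgamated product any `y` and `z` form a tripod `y = u g v⁻¹`, `z = v h w⁻¹`,
`y z = u (g h) w⁻¹` without cancellation, in which `g`, `h` and `g h` lie in a single factor. After
choosing representatives, `u`, `v`, `w` depend only on their cosets modulo the base group, and an
element is determined together with its level `2 |u| + |g|` by these cosets and the middle letter
without repetition. So the form on the amalgam is at most a sum over the levels of `y` and `z` of
coset-indexed forms on the factors. There are at most `2 |y| + 1 ≤ 2n + 1` values for each level,
which yields the factor `(2n + 1)²`; and if the representatives have minimal length, the middle
letter of `y` has length at most twice that of `y`, which yields the argument `2n`.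

Real-valued lengths reduce to the integer-valued case: rounding up and adding `1` off the base group
gives integer-valued lengths which dominate them and are nonzero off the base group.
-/

open scoped ENNReal NNReal

section EllTwoNorm

/-- The `ℓ²`-norm of a `[0, ∞]`-valued function, with the value `∞` on functions which are not
square summable. -/
noncomputable def ellTwoNorm {ι : Type*} (φ : ι → ℝ≥0∞) : ℝ≥0∞ :=
  (∑' i, φ i ^ 2) ^ (1 / 2 : ℝ)

variable {ι κ : Type*}

theorem ellTwoNorm_sq (φ : ι → ℝ≥0∞) : ellTwoNorm φ ^ 2 = ∑' i, φ i ^ 2 := by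
  rw [ellTwoNorm, ← ENNReal.rpow_two, ← ENNReal.rpow_mul]
  norm_num

theorem ellTwoNorm_eq_iff {φ : ι → ℝ≥0∞} {a : ℝ≥0∞} :
    ellTwoNorm φ = a ↔ ∑' i, φ i ^ 2 = a ^ 2 := by
  simp only [← ellTwoNorm_sq, le_antisymm_iff, ENNReal.pow_le_pow_left_iff two_ne_zero]

theorem ellTwoNorm_le_iff {φ : ι → ℝ≥0∞} {a : ℝ≥0∞} :
    ellTwoNorm φ ≤ a ↔ ∑' i, φ i ^ 2 ≤ a ^ 2 := by
  rw [← ellTwoNorm_sq, ENNReal.pow_le_pow_left_iff two_ne_zero]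

theorem ellTwoNorm_le_ellTwoNorm {φ : ι → ℝ≥0∞} {ψ : κ → ℝ≥0∞}
    (h : ∑' i, φ i ^ 2 ≤ ∑' k, ψ k ^ 2) : ellTwoNorm φ ≤ ellTwoNorm ψ := by
  rwa [ellTwoNorm_le_iff, ellTwoNorm_sq]

theorem apply_le_ellTwoNorm (φ : ι → ℝ≥0∞) (i : ι) : φ i ≤ ellTwoNorm φ := by
  rw [← ENNReal.pow_le_pow_left_iff two_ne_zero, ellTwoNorm_sq]
  exact ENNReal.le_tsum i

theorem ellTwoNorm_eq_zero {φ : ι → ℝ≥0∞} : ellTwoNorm φ = 0 ↔ φ = 0 := by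
  simp [ellTwoNorm_eq_iff, funext_iff]

theorem tsum_mul_le_ellTwoNorm_mul (φ ψ : ι → ℝ≥0∞) :
    ∑' i, φ i * ψ i ≤ ellTwoNorm φ * ellTwoNorm ψ := by
  rw [ENNReal.tsum_eq_iSup_sum]
  refine iSup_le fun s => (ENNReal.inner_le_Lp_mul_Lq s φ ψ .two_two).trans ?_
  simp only [ENNReal.rpow_two]
  unfold ellTwoNorm
  gcongr <;> exact ENNReal.sum_le_tsum s

theorem tsum_mul_mul_le_ellTwoNorm_mul (φ ψ χ : ι → ℝ≥0∞) :
    ∑' i, φ i * ψ i * χ i ≤ ellTwoNorm φ * ellTwoNorm ψ * ellTwoNorm χ :=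
  calc ∑' i, φ i * ψ i * χ i ≤ ∑' i, φ i * ψ i * ellTwoNorm χ :=
        ENNReal.tsum_le_tsum fun i => by gcongr; exact apply_le_ellTwoNorm χ i
    _ ≤ ellTwoNorm φ * ellTwoNorm ψ * ellTwoNorm χ := by
        rw [ENNReal.tsum_mul_right]
        gcongr
        exact tsum_mul_le_ellTwoNorm_mul φ ψ

theorem ellTwoNorm_sigma {κ : ι → Type*} (φ : (Σ i, κ i) → ℝ≥0∞) :
    (ellTwoNorm fun i => ellTwoNorm fun k => φ ⟨i, k⟩) = ellTwoNorm φ := by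
  simp only [ellTwoNorm_eq_iff, ellTwoNorm_sq, ENNReal.tsum_sigma']

theorem ellTwoNorm_prod (φ : ι × κ → ℝ≥0∞) :
    (ellTwoNorm fun i => ellTwoNorm fun k => φ (i, k)) = ellTwoNorm φ := by
  simp only [ellTwoNorm_eq_iff, ellTwoNorm_sq, ENNReal.tsum_prod']

theorem ellTwoNorm_comp_equiv (e : κ ≃ ι) (φ : ι → ℝ≥0∞) :
    (ellTwoNorm fun k => φ (e k)) = ellTwoNorm φ := by
  rw [ellTwoNorm_eq_iff, ellTwoNorm_sq]
  exact e.tsum_eq fun i => φ i ^ 2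

theorem ellTwoNorm_tensor (φ : ι → ℝ≥0∞) (ψ : κ → ℝ≥0∞) :
    (ellTwoNorm fun x : ι × κ => φ x.1 * ψ x.2) = ellTwoNorm φ * ellTwoNorm ψ := by
  simp only [ellTwoNorm_eq_iff, mul_pow, ellTwoNorm_sq, ENNReal.tsum_prod',
    ENNReal.tsum_mul_left, ENNReal.tsum_mul_right]

theorem ellTwoNorm_indicator_comp_le {F : κ → ι} {S : Set κ} (hF : S.InjOn F) (φ : ι → ℝ≥0∞) :
    ellTwoNorm (S.indicator fun k => φ (F k)) ≤ ellTwoNorm φ := by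
  refine ellTwoNorm_le_ellTwoNorm ?_
  have hind : (fun k => S.indicator (fun k => φ (F k)) k ^ 2)
      = S.indicator fun k => φ (F k) ^ 2 := by
    funext k
    by_cases hk : k ∈ S <;> simp [hk]
  rw [hind, ← tsum_subtype]
  exact ENNReal.tsum_comp_le_tsum_of_injective hF.injective fun i => φ i ^ 2

theorem tsum_triangle_le_ellTwoNorm {U V W : Type*} (α : U × V → ℝ≥0∞) (β : V × W → ℝ≥0∞)
    (γ : U × W → ℝ≥0∞) :
    ∑' x : U × V × W, α (x.1, x.2.1) * β (x.2.1, x.2.2) * γ (x.1, x.2.2)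
      ≤ ellTwoNorm α * ellTwoNorm β * ellTwoNorm γ :=
  calc ∑' x : U × V × W, α (x.1, x.2.1) * β (x.2.1, x.2.2) * γ (x.1, x.2.2)
      = ∑' y : U × W, (∑' v, α (y.1, v) * β (v, y.2)) * γ y := by
        simp only [ENNReal.tsum_prod', ← ENNReal.tsum_mul_right]
        exact tsum_congr fun u => ENNReal.tsum_comm
    _ ≤ ∑' y : U × W, (ellTwoNorm fun v => α (y.1, v)) * (ellTwoNorm fun v => β (v, y.2)) * γ y :=
        ENNReal.tsum_le_tsum fun y => by gcongr; exact tsum_mul_le_ellTwoNorm_mul _ _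
    _ ≤ ellTwoNorm α * ellTwoNorm β * ellTwoNorm γ := by
        refine (tsum_mul_le_ellTwoNorm_mul _ _).trans_eq ?_
        have hβ := ellTwoNorm_prod fun y : W × V => β y.swap
        have hswap := ellTwoNorm_comp_equiv (Equiv.prodComm W V) β
        rw [ellTwoNorm_tensor (fun u => ellTwoNorm fun v => α (u, v))
          (fun w => ellTwoNorm fun v => β (v, w)), ellTwoNorm_prod]
        exact congrArg (ellTwoNorm α * · * ellTwoNorm γ) (hβ.trans hswap)

theorem tsum_le_tsum_of_exists_lift {X Y : Type*} {F : X → Y} {a : Y → ℝ≥0∞} {b : X → ℝ≥0∞}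
    (h : ∀ y, a y ≠ 0 → ∃ x, F x = y ∧ a y ≤ b x) : ∑' y, a y ≤ ∑' x, b x := by
  choose σ hFσ hab using h
  have hσ : Function.Injective fun y : Function.support a => σ y y.2 := fun y z hyz =>
    Subtype.ext <| by rw [← hFσ y y.2, ← hFσ z z.2]; exact congrArg F hyz
  calc ∑' y, a y = ∑' y : Function.support a, a y := (tsum_subtype_support a).symm
    _ ≤ ∑' y : Function.support a, b (σ y y.2) := ENNReal.tsum_le_tsum fun y => hab y y.2
    _ ≤ ∑' x, b x := ENNReal.tsum_comp_le_tsum_of_injective hσ b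

end EllTwoNorm

section Trilinear

variable {G : Type*} [Group G]

/-- The form `⟨φ * ψ, χ⟩ = ∑ φ(g) ψ(h) χ(gh)` attached to the convolution of a group. -/
noncomputable def trilinear (φ ψ χ : G → ℝ≥0∞) : ℝ≥0∞ :=
  ∑' x : G × G, φ x.1 * ψ x.2 * χ (x.1 * x.2)

/-- Convolution by an `ℓ²`-function supported in `S` has norm at most `c` times the `ℓ²`-norm of
that function. This is the form in which the decay property is carried to an amalgam. -/
def TrilinearBound (S : Set G) (c : ℝ≥0∞) : Prop :=
  ∀ φ ψ χ : G → ℝ≥0∞, Function.support φ ⊆ S →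
    trilinear φ ψ χ ≤ c * (ellTwoNorm φ * ellTwoNorm ψ * ellTwoNorm χ)

theorem trilinear_eq_tsum_tsum (φ ψ χ : G → ℝ≥0∞) :
    trilinear φ ψ χ = ∑' (g : G) (k : G), φ g * ψ (g⁻¹ * k) * χ k := by
  rw [trilinear, ENNReal.tsum_prod']
  refine tsum_congr fun g => ?_
  rw [← (Equiv.mulLeft g).tsum_eq fun k => φ g * ψ (g⁻¹ * k) * χ k]
  simp only [Equiv.coe_mulLeft, inv_mul_cancel_left]

theorem TrilinearBound.mono {S S' : Set G} {c : ℝ≥0∞} (h : TrilinearBound S c) (hS : S' ⊆ S) :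
    TrilinearBound S' c :=
  fun φ ψ χ hφ => h φ ψ χ (hφ.trans hS)

theorem TrilinearBound.tsum_triangle_le {R U V W : Type*} {E : R → Type*} [∀ r, Group (E r)]
    {S : ∀ r, Set (E r)} {c : ℝ≥0∞} (hS : ∀ r, TrilinearBound (S r) c)
    (α : (Σ r, (U × V) × E r) → ℝ≥0∞) (β : (Σ r, (V × W) × E r) → ℝ≥0∞)
    (γ : (Σ r, (U × W) × E r) → ℝ≥0∞) (hα : ∀ r x s, α ⟨r, x, s⟩ ≠ 0 → s ∈ S r) :
    ∑' x : Σ r, (U × V × W) × (E r × E r),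
        α ⟨x.1, (x.2.1.1, x.2.1.2.1), x.2.2.1⟩ * β ⟨x.1, (x.2.1.2.1, x.2.1.2.2), x.2.2.2⟩
          * γ ⟨x.1, (x.2.1.1, x.2.1.2.2), x.2.2.1 * x.2.2.2⟩
      ≤ c * (ellTwoNorm α * ellTwoNorm β * ellTwoNorm γ) := by
  have hfibre : ∀ r (u : U) (v : V) (w : W),
      trilinear (fun s => α ⟨r, (u, v), s⟩) (fun s => β ⟨r, (v, w), s⟩)
          (fun s => γ ⟨r, (u, w), s⟩)
        ≤ c * ((ellTwoNorm fun s => α ⟨r, (u, v), s⟩) * (ellTwoNorm fun s => β ⟨r, (v, w), s⟩)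
            * (ellTwoNorm fun s => γ ⟨r, (u, w), s⟩)) :=
    fun r u v w => hS r _ _ _ fun s hs => hα r _ s hs
  calc _ = ∑' (r : R) (x : U × V × W),
        trilinear (fun s => α ⟨r, (x.1, x.2.1), s⟩) (fun s => β ⟨r, (x.2.1, x.2.2), s⟩)
          (fun s => γ ⟨r, (x.1, x.2.2), s⟩) := by
        rw [ENNReal.tsum_sigma']
        exact tsum_congr fun r => ENNReal.tsum_prod'
    _ ≤ ∑' (r : R), c * ((ellTwoNorm fun x => α ⟨r, x⟩) * (ellTwoNorm fun x => β ⟨r, x⟩)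
          * ellTwoNorm fun x => γ ⟨r, x⟩) := by
        refine ENNReal.tsum_le_tsum fun r =>
          (ENNReal.tsum_le_tsum fun x : U × V × W => hfibre r x.1 x.2.1 x.2.2).trans ?_
        rw [ENNReal.tsum_mul_left]
        gcongr
        refine (tsum_triangle_le_ellTwoNorm (fun y : U × V => ellTwoNorm fun s => α ⟨r, y, s⟩)
          (fun y : V × W => ellTwoNorm fun s => β ⟨r, y, s⟩)
          (fun y : U × W => ellTwoNorm fun s => γ ⟨r, y, s⟩)).trans_eq ?_
        rw [ellTwoNorm_prod fun x => α ⟨r, x⟩, ellTwoNorm_prod fun x => β ⟨r, x⟩,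
          ellTwoNorm_prod fun x => γ ⟨r, x⟩]
    _ ≤ c * (ellTwoNorm α * ellTwoNorm β * ellTwoNorm γ) := by
        rw [ENNReal.tsum_mul_left, ← ellTwoNorm_sigma α, ← ellTwoNorm_sigma β,
          ← ellTwoNorm_sigma γ]
        gcongr
        exact tsum_mul_mul_le_ellTwoNorm_mul _ _ _

end Trilinear

section Decay

theorem enorm_ofReal_nnreal (r : ℝ≥0) : ‖((r : ℝ) : ℂ)‖ₑ = r := by
  rw [← ofReal_norm, Complex.norm_real, NNReal.norm_eq, ENNReal.ofReal_coe_nnreal]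

theorem ellTwoNorm_enorm {G : Type*} (ξ : EllTwo G) : (ellTwoNorm fun g => ‖ξ g‖ₑ) = ‖ξ‖ₑ := by
  have hsum := lp.hasSum_norm (show 0 < (2 : ℝ≥0∞).toReal by norm_num) ξ
  simp only [ENNReal.toReal_ofNat, Real.rpow_two] at hsum
  have henorm := ENNReal.ofReal_tsum_of_nonneg (fun g => sq_nonneg ‖ξ g‖) hsum.summable
  simp only [hsum.tsum_eq, ENNReal.ofReal_pow (norm_nonneg _), ofReal_norm] at henorm
  exact ellTwoNorm_eq_iff.2 henorm.symm

theorem exists_ellTwo_eq_of_ellTwoNorm_ne_top {G : Type*} {ψ : G → ℝ≥0}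
    (hψ : (ellTwoNorm fun g => (ψ g : ℝ≥0∞)) ≠ ∞) : ∃ ξ : EllTwo G, ∀ g, ξ g = (ψ g : ℝ) := by
  have htop : ∑' g, (ψ g : ℝ≥0∞) ^ 2 ≠ ∞ := by
    rw [← ellTwoNorm_sq]
    exact ENNReal.pow_ne_top hψ
  refine ⟨⟨fun g => (ψ g : ℝ), (memℓp_gen_iff (by norm_num)).2 ?_⟩, fun _ => rfl⟩
  simpa [ENNReal.toReal_pow] using ENNReal.summable_toReal htop

variable {G : Type*} [Group G]

theorem twoNorm_nonneg (x : MonoidAlgebra ℂ G) : 0 ≤ twoNorm x := Real.sqrt_nonneg _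

theorem ofReal_twoNorm (x : MonoidAlgebra ℂ G) :
    ENNReal.ofReal (twoNorm x) = ellTwoNorm fun g => ‖x.coeff g‖ₑ := by
  rw [eq_comm, ellTwoNorm_eq_iff, twoNorm, ← ENNReal.ofReal_pow (Real.sqrt_nonneg _),
    Real.sq_sqrt (by positivity), ENNReal.ofReal_sum_of_nonneg fun _ _ => by positivity,
    tsum_eq_sum (s := x.coeff.support) fun g hg => by simp [Finsupp.notMem_support_iff.1 hg]]
  simp only [ENNReal.ofReal_pow (norm_nonneg _), ofReal_norm]

theorem lift_leftRegular_apply (x : MonoidAlgebra ℂ G) (ξ : EllTwo G) (k : G) :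
    MonoidAlgebra.lift ℂ (EllTwo G →L[ℂ] EllTwo G) G (leftRegular G) x ξ k =
      ∑ g ∈ x.coeff.support, x.coeff g * ξ (g⁻¹ * k) := by
  rw [MonoidAlgebra.lift_apply, Finsupp.sum, sum_apply, lp.coeFn_sum,
    Finset.sum_apply]
  rfl

theorem lift_leftRegular_sum_single_apply (s : Finset G) (c : G → ℂ) (ξ : EllTwo G) (k : G) :
    MonoidAlgebra.lift ℂ (EllTwo G →L[ℂ] EllTwo G) G (leftRegular G)
        (∑ g ∈ s, MonoidAlgebra.single g (c g)) ξ k =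
      ∑ g ∈ s, c g * ξ (g⁻¹ * k) := by
  simp only [map_sum, MonoidAlgebra.lift_single, sum_apply, lp.coeFn_sum, Finset.sum_apply]
  rfl

theorem enorm_sq_lift_leftRegular_le (x : MonoidAlgebra ℂ G) (ξ : EllTwo G) {η : EllTwo G}
    (hη : MonoidAlgebra.lift ℂ (EllTwo G →L[ℂ] EllTwo G) G (leftRegular G) x ξ = η) :
    ‖η‖ₑ ^ 2 ≤ trilinear (fun g => ‖x.coeff g‖ₑ) (fun g => ‖ξ g‖ₑ) (fun g => ‖η g‖ₑ) := by
  rw [← ellTwoNorm_enorm, ellTwoNorm_sq, trilinear_eq_tsum_tsum, ENNReal.tsum_comm]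
  refine ENNReal.tsum_le_tsum fun k => ?_
  rw [ENNReal.tsum_mul_right, sq]
  gcongr
  rw [← hη, lift_leftRegular_apply]
  refine (enorm_sum_le _ _).trans ?_
  simp only [enorm_mul]
  exact ENNReal.sum_le_tsum _

theorem TrilinearBound.reducedNorm_le {S : Set G} {c : ℝ} (h : TrilinearBound S (ENNReal.ofReal c))
    (hc : 0 ≤ c) (x : MonoidAlgebra ℂ G) (hx : ∀ g ∈ x.coeff.support, g ∈ S) :
    reducedNorm x ≤ c * twoNorm x := by
  have htwo := twoNorm_nonneg x
  refine ContinuousLinearMap.opNorm_le_bound _ (by positivity) fun ξ => ?_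
  set η := MonoidAlgebra.lift ℂ (EllTwo G →L[ℂ] EllTwo G) G (leftRegular G) x ξ with hη
  have hsq : ‖η‖ ^ 2 ≤ c * (twoNorm x * ‖ξ‖ * ‖η‖) := by
    have hle := (enorm_sq_lift_leftRegular_le x ξ hη.symm).trans <|
      h _ _ _ fun g hg => hx g <| Finsupp.mem_support_iff.2 fun hzero => hg <| by simp [hzero]
    rw [← ofReal_twoNorm, ellTwoNorm_enorm, ellTwoNorm_enorm, ← ofReal_norm, ← ofReal_norm,
      ← ENNReal.ofReal_pow (norm_nonneg _), ← ENNReal.ofReal_mul htwo,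
      ← ENNReal.ofReal_mul (by positivity), ← ENNReal.ofReal_mul hc] at hle
    exact (ENNReal.ofReal_le_ofReal_iff (by positivity)).1 hle
  rcases (norm_nonneg η).eq_or_lt with hzero | hpos
  · rw [← hzero]
    positivity
  · exact le_of_mul_le_mul_right (by linarith) hpos

theorem twoNorm_one : twoNorm (1 : MonoidAlgebra ℂ G) = 1 := by
  simp [twoNorm, MonoidAlgebra.one_def]

theorem reducedNorm_one : reducedNorm (1 : MonoidAlgebra ℂ G) = 1 := by
  classical
  have : Nontrivial (EllTwo G) :=
    ⟨lp.single 2 (1 : G) (1 : ℂ), 0, fun hzero => by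
      simpa using congrArg (fun ξ : EllTwo G => ξ 1) hzero⟩
  rw [reducedNorm, map_one, norm_one]

theorem HasDecay.one_le {l : G → ℝ} {f : ℕ → ℝ} (h : HasDecay l f) (hl : l 1 ≤ 0) (n : ℕ) :
    1 ≤ f n := by
  have hsupp : ∀ g ∈ (1 : MonoidAlgebra ℂ G).coeff.support, l g ≤ n := fun g hg => by
    rw [MonoidAlgebra.one_def, MonoidAlgebra.coeff_single] at hg
    rw [Finset.mem_singleton.1 (Finsupp.support_single_subset hg)]
    exact hl.trans n.cast_nonneg
  simpa only [reducedNorm_one, twoNorm_one, mul_one] using h n 1 hsupp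

theorem HasDecay.mono {l l' : G → ℝ} {f f' : ℕ → ℝ} (h : HasDecay l f)
    (hl : ∀ g, l g ≤ l' g) (hf : ∀ n, f n ≤ f' n) : HasDecay l' f' := fun n x hx =>
  (h n x fun g hg => (hl g).trans (hx g hg)).trans <|
    mul_le_mul_of_nonneg_right (hf n) (twoNorm_nonneg x)

theorem trilinearBound_of_nnreal {S : Set G} {c : ℝ≥0∞} (hc : c ≠ 0)
    (h : ∀ (φ ψ : G → ℝ≥0) (χ : G → ℝ≥0∞), (∀ g, φ g ≠ 0 → g ∈ S) →
      (ellTwoNorm fun g => (ψ g : ℝ≥0∞)) ≠ ∞ →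
      trilinear (fun g => φ g) (fun g => ψ g) χ
        ≤ c * ((ellTwoNorm fun g => (φ g : ℝ≥0∞)) * (ellTwoNorm fun g => (ψ g : ℝ≥0∞))
            * ellTwoNorm χ)) :
    TrilinearBound S c := by
  intro φ ψ χ hφ
  by_cases hzero : φ = 0 ∨ ψ = 0 ∨ χ = 0
  · refine le_of_eq_of_le ?_ zero_le
    rcases hzero with rfl | rfl | rfl <;> simp [trilinear]
  simp only [← ellTwoNorm_eq_zero, not_or] at hzero
  obtain ⟨hφ₀, hψ₀, hχ₀⟩ := hzero
  by_cases htop : ellTwoNorm φ = ∞ ∨ ellTwoNorm ψ = ∞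
  · refine le_top.trans_eq (Eq.symm ?_)
    rcases htop with htop | htop <;>
      simp [htop, hc, hφ₀, hψ₀, hχ₀, ENNReal.top_mul, ENNReal.mul_top]
  obtain ⟨hφ_top, hψ_top⟩ := not_or.1 htop
  lift φ to G → ℝ≥0 using fun g => ne_top_of_le_ne_top hφ_top (apply_le_ellTwoNorm φ g)
  lift ψ to G → ℝ≥0 using fun g => ne_top_of_le_ne_top hψ_top (apply_le_ellTwoNorm ψ g)
  exact h φ ψ χ (fun g hg => hφ (by simpa using hg)) hψ_top

theorem HasDecay.ellTwoNorm_convolution_le {l : G → ℝ} {f : ℕ → ℝ} (h : HasDecay l f) {n : ℕ}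
    (hf : 0 ≤ f n) (φ ψ : G → ℝ≥0) (s : Finset G) (hs : ∀ g ∈ s, φ g ≠ 0 → l g ≤ n)
    (hψ : (ellTwoNorm fun g => (ψ g : ℝ≥0∞)) ≠ ∞) :
    (ellTwoNorm fun k => ∑ g ∈ s, (φ g * ψ (g⁻¹ * k) : ℝ≥0∞))
      ≤ ENNReal.ofReal (f n)
        * ((ellTwoNorm fun g => (φ g : ℝ≥0∞)) * ellTwoNorm fun g => (ψ g : ℝ≥0∞)) := by
  classical
  obtain ⟨ξ, hξ⟩ := exists_ellTwo_eq_of_ellTwoNorm_ne_top hψ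
  have hξ_enorm : ‖ξ‖ₑ = ellTwoNorm fun g => (ψ g : ℝ≥0∞) := by
    simp only [← ellTwoNorm_enorm, hξ, enorm_ofReal_nnreal]
  set x : MonoidAlgebra ℂ G := ∑ g ∈ s, MonoidAlgebra.single g ((φ g : ℝ) : ℂ) with hx
  have hcoeff : ∀ g, x.coeff g = if g ∈ s then ((φ g : ℝ) : ℂ) else 0 := fun g => by
    simp [hx, MonoidAlgebra.coeff_sum, Finsupp.finsetSum_apply, Finsupp.single_apply]
  have hx_supp : ∀ g ∈ x.coeff.support, g ∈ s ∧ φ g ≠ 0 := fun g hg => by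
    simpa [hcoeff] using hg
  have hx_two : ENNReal.ofReal (twoNorm x) ≤ ellTwoNorm fun g => (φ g : ℝ≥0∞) := by
    rw [ofReal_twoNorm]
    refine ellTwoNorm_le_ellTwoNorm (ENNReal.tsum_le_tsum fun g => ?_)
    rw [hcoeff]
    split_ifs <;> simp [enorm_ofReal_nnreal]
  set η := MonoidAlgebra.lift ℂ (EllTwo G →L[ℂ] EllTwo G) G (leftRegular G) x ξ with hη
  have hη_apply : ∀ k, ‖η k‖ₑ = ∑ g ∈ s, (φ g * ψ (g⁻¹ * k) : ℝ≥0∞) := fun k => by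
    have hη_k : η k = ((∑ g ∈ s, φ g * ψ (g⁻¹ * k) : ℝ≥0) : ℝ) := by
      rw [hη, lift_leftRegular_sum_single_apply]
      simp only [hξ]
      push_cast
      rfl
    rw [hη_k, enorm_ofReal_nnreal]
    push_cast
    rfl
  have hη_norm : ‖η‖ ≤ f n * (twoNorm x * ‖ξ‖) := by
    rw [← mul_assoc]
    exact ContinuousLinearMap.le_of_opNorm_le _ (h n x fun g hg => (hx_supp g hg).elim (hs g)) ξ
  calc (ellTwoNorm fun k => ∑ g ∈ s, (φ g * ψ (g⁻¹ * k) : ℝ≥0∞)) = ENNReal.ofReal ‖η‖ := by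
        rw [ofReal_norm, ← ellTwoNorm_enorm]
        simp only [hη_apply]
    _ ≤ ENNReal.ofReal (f n * (twoNorm x * ‖ξ‖)) := ENNReal.ofReal_le_ofReal hη_norm
    _ ≤ _ := by
        rw [ENNReal.ofReal_mul hf, ENNReal.ofReal_mul (twoNorm_nonneg x), ofReal_norm, hξ_enorm]
        gcongr

theorem HasDecay.trilinearBound {l : G → ℝ} {f : ℕ → ℝ} (h : HasDecay l f) (hl : l 1 ≤ 0)
    (n : ℕ) : TrilinearBound {g | l g ≤ n} (ENNReal.ofReal (f n)) := by
  have hf : 0 < f n := zero_lt_one.trans_le (h.one_le hl n)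
  refine trilinearBound_of_nnreal (ENNReal.ofReal_pos.2 hf).ne' fun φ ψ χ hφ hψ => ?_
  rw [trilinear_eq_tsum_tsum, ENNReal.tsum_eq_iSup_sum]
  refine iSup_le fun s => ?_
  calc ∑ g ∈ s, ∑' k, (φ g * ψ (g⁻¹ * k) : ℝ≥0∞) * χ k
      = ∑' k, (∑ g ∈ s, (φ g * ψ (g⁻¹ * k) : ℝ≥0∞)) * χ k := by
        simp only [Finset.sum_mul]
        exact (Summable.tsum_finsetSum fun _ _ => ENNReal.summable).symm
    _ ≤ _ := by
        refine (tsum_mul_le_ellTwoNorm_mul _ _).trans ?_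
        rw [← mul_assoc]
        gcongr
        exact h.ellTwoNorm_convolution_le hf.le φ ψ s (fun g _ => hφ g) hψ

end Decay

open Monoid Monoid.PushoutI

theorem isLengthFunction_natCast_iff {G : Type*} [Group G] {l : G → ℕ} :
    IsLengthFunction (fun g => (l g : ℝ)) ↔
      l 1 = 0 ∧ (∀ g, l g⁻¹ = l g) ∧ ∀ g h, l (g * h) ≤ l g + l h := by
  refine ⟨fun hl => ⟨by exact_mod_cast hl.map_one, fun g => by exact_mod_cast hl.map_inv g,
    fun g h => by exact_mod_cast hl.map_mul_le g h⟩, fun ⟨hone, hinv, hmul⟩ =>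
    ⟨fun _ => Nat.cast_nonneg _, by rw [hone, Nat.cast_zero], fun g => by rw [hinv],
      fun g h => by exact_mod_cast hmul g h⟩⟩

section WordLength

variable {ι A : Type*} {K : ι → Type*} [∀ i, Group (K i)] [Group A] (φ : ∀ i, A →* K i)

/-- A list of letters outside the base group, with adjacent letters in different factors. -/
def IsReducedList (l : List (Σ i, K i)) : Prop :=
  (∀ s ∈ l, s.2 ∉ (φ s.1).range) ∧ l.IsChain fun s t => s.1 ≠ t.1

/-- The product of a list of letters in the amalgamated product. -/
def listProd (l : List (Σ i, K i)) : PushoutI φ := (l.map fun s => of s.1 s.2).prod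

/-- The length on an amalgamated product given by lengths on the base group and on the letters:
the minimum of the total length of `a s₁ ⋯ sₘ` over the reduced ways to write an element. For the
two factors of `G *_A H` this unfolds to `amalgamLength`. -/
noncomputable def wordLength (ℓ₀ : A → ℕ) (ℓ : (Σ i, K i) → ℕ) (k : PushoutI φ) : ℕ :=
  sInf {n : ℕ | ∃ (a : A) (w : CoprodI.Word K), Reduced φ w ∧
    base φ a * ofCoprodI w.prod = k ∧ n = ℓ₀ a + (w.toList.map ℓ).sum}

/-- The element `k` can be written as `a s₁ ⋯ sₘ` with `s₁, …, sₘ` reduced and total length at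
most `n`. -/
def HasReducedExpression (ℓ₀ : A → ℕ) (ℓ : (Σ i, K i) → ℕ) (k : PushoutI φ) (n : ℕ) : Prop :=
  ∃ a l, IsReducedList φ l ∧ base φ a * listProd φ l = k ∧ ℓ₀ a + (l.map ℓ).sum ≤ n

/-- Length functions on the base group and on the factors which agree on the base group. -/
structure IsLetterLength (ℓ₀ : A → ℕ) (ℓ : (Σ i, K i) → ℕ) : Prop where
  base : IsLengthFunction fun a => (ℓ₀ a : ℝ)
  letter : ∀ i, IsLengthFunction fun x : K i => (ℓ ⟨i, x⟩ : ℝ)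
  map_base : ∀ i a, ℓ ⟨i, φ i a⟩ = ℓ₀ a

variable {φ}

theorem listProd_nil : listProd φ [] = 1 := rfl

theorem listProd_cons (s : Σ i, K i) (l : List (Σ i, K i)) :
    listProd φ (s :: l) = of s.1 s.2 * listProd φ l := List.prod_cons

theorem listProd_append (l m : List (Σ i, K i)) :
    listProd φ (l ++ m) = listProd φ l * listProd φ m := by
  simp only [listProd, List.map_append, List.prod_append]

theorem isReducedList_nil : IsReducedList φ [] := ⟨by simp, .nil⟩

theorem isReducedList_cons {s : Σ i, K i} {l : List (Σ i, K i)} :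
    IsReducedList φ (s :: l) ↔
      s.2 ∉ (φ s.1).range ∧ (∀ t ∈ l.head?, s.1 ≠ t.1) ∧ IsReducedList φ l := by
  simp only [IsReducedList, List.forall_mem_cons, List.isChain_cons]
  tauto

theorem IsReducedList.drop {l : List (Σ i, K i)} (hl : IsReducedList φ l) (n : ℕ) :
    IsReducedList φ (l.drop n) :=
  ⟨fun s hs => hl.1 s (List.mem_of_mem_drop hs), hl.2.drop n⟩

theorem ofCoprodI_prod (w : CoprodI.Word K) :
    (ofCoprodI w.prod : PushoutI φ) = listProd φ w.toList := by
  rw [CoprodI.Word.prod, map_list_prod, List.map_map]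
  rfl

theorem IsReducedList.exists_word {l : List (Σ i, K i)} (hl : IsReducedList φ l) :
    ∃ w : CoprodI.Word K, w.toList = l ∧ Reduced φ w :=
  ⟨⟨l, fun s hs hone => hl.1 s hs ⟨1, by rw [hone, map_one]⟩, hl.2⟩, rfl, hl.1⟩

theorem wordLength_eq_sInf (ℓ₀ : A → ℕ) (ℓ : (Σ i, K i) → ℕ) (k : PushoutI φ) :
    wordLength φ ℓ₀ ℓ k = sInf {n : ℕ | ∃ a l, IsReducedList φ l ∧ base φ a * listProd φ l = k ∧
      n = ℓ₀ a + (l.map ℓ).sum} := by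
  refine congrArg sInf (Set.ext fun n => exists_congr fun a => ⟨?_, ?_⟩)
  · rintro ⟨w, hw, hk, hn⟩
    exact ⟨w.toList, ⟨hw, w.chain_ne⟩, by rw [← ofCoprodI_prod, hk], hn⟩
  · rintro ⟨_, hl, hk, hn⟩
    obtain ⟨w, rfl, hw⟩ := hl.exists_word
    exact ⟨w, hw, by rw [ofCoprodI_prod, hk], hn⟩

variable {ℓ₀ : A → ℕ} {ℓ : (Σ i, K i) → ℕ}

theorem HasReducedExpression.base_mul (hℓ : IsLetterLength φ ℓ₀ ℓ) {k : PushoutI φ} {n : ℕ}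
    (hk : HasReducedExpression φ ℓ₀ ℓ k n) (b : A) :
    HasReducedExpression φ ℓ₀ ℓ (base φ b * k) (ℓ₀ b + n) := by
  obtain ⟨a, l, hl, rfl, hn⟩ := hk
  refine ⟨b * a, l, hl, by rw [map_mul, mul_assoc], ?_⟩
  have := (isLengthFunction_natCast_iff.1 hℓ.base).2.2 b a
  omega

theorem IsLetterLength.hasReducedExpression_of_mul (hℓ : IsLetterLength φ ℓ₀ ℓ) {i : ι} (x : K i)
    {l : List (Σ i, K i)} (hl : IsReducedList φ l) (hhead : ∀ t ∈ l.head?, i ≠ t.1) :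
    HasReducedExpression φ ℓ₀ ℓ (of i x * listProd φ l) (ℓ ⟨i, x⟩ + (l.map ℓ).sum) := by
  by_cases hx : x ∈ (φ i).range
  · obtain ⟨b, rfl⟩ := hx
    exact ⟨b, l, hl, by rw [of_apply_eq_base], by rw [hℓ.map_base]⟩
  · refine ⟨1, ⟨i, x⟩ :: l, isReducedList_cons.2 ⟨hx, hhead, hl⟩,
      by rw [map_one, one_mul, listProd_cons], ?_⟩
    rw [(isLengthFunction_natCast_iff.1 hℓ.base).1, List.map_cons, List.sum_cons, zero_add]

theorem HasReducedExpression.of_mul (hℓ : IsLetterLength φ ℓ₀ ℓ) {k : PushoutI φ} {n : ℕ}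
    (hk : HasReducedExpression φ ℓ₀ ℓ k n) (i : ι) (x : K i) :
    HasReducedExpression φ ℓ₀ ℓ (of i x * k) (ℓ ⟨i, x⟩ + n) := by
  obtain ⟨a, l, hl, rfl, hn⟩ := hk
  have hmul := (isLengthFunction_natCast_iff.1 (hℓ.letter i)).2.2
  have hxa := hmul x (φ i a)
  rw [hℓ.map_base] at hxa
  suffices hsplit : ∃ (y : K i) (m : List (Σ i, K i)), IsReducedList φ m ∧
      (∀ t ∈ m.head?, i ≠ t.1) ∧ of i y * listProd φ m = of i x * (base φ a * listProd φ l) ∧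
      ℓ ⟨i, y⟩ + (m.map ℓ).sum ≤ ℓ ⟨i, x⟩ + n by
    obtain ⟨y, m, hm, hhead, hprod, hle⟩ := hsplit
    obtain ⟨b, m', hm', hprod', hle'⟩ := hℓ.hasReducedExpression_of_mul y hm hhead
    exact ⟨b, m', hm', hprod'.trans hprod, hle'.trans hle⟩
  by_cases hhead : ∀ t ∈ l.head?, i ≠ t.1
  · exact ⟨x * φ i a, l, hl, hhead, by rw [map_mul, of_apply_eq_base, mul_assoc], by omega⟩
  · obtain ⟨⟨j, y⟩, m, rfl, rfl⟩ : ∃ t m, l = t :: m ∧ i = t.1 := by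
      cases l with
      | nil => simp at hhead
      | cons t m => exact ⟨t, m, rfl, by simpa using hhead⟩
    obtain ⟨-, hhead', hm⟩ := isReducedList_cons.1 hl
    refine ⟨x * φ i a * y, m, hm, hhead', ?_, ?_⟩
    · simp only [map_mul, of_apply_eq_base, listProd_cons, mul_assoc]
    · have := hmul (x * φ i a) y
      simp only [List.map_cons, List.sum_cons] at hn
      omega

theorem isLetterLength_zero : IsLetterLength φ (fun _ => 0) fun _ => 0 where
  base := isLengthFunction_natCast_iff.2 (by simp)
  letter _ := isLengthFunction_natCast_iff.2 (by simp)
  map_base _ _ := rfl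

theorem exists_eq_base_mul_listProd (k : PushoutI φ) :
    ∃ a l, IsReducedList φ l ∧ base φ a * listProd φ l = k := by
  suffices h : ∀ k' n, HasReducedExpression φ (fun _ => 0) (fun _ => 0) k' n →
      ∃ n', HasReducedExpression φ (fun _ => 0) (fun _ => 0) (k * k') n' by
    obtain ⟨_, a, l, hl, hk, -⟩ :=
      h 1 0 ⟨1, [], isReducedList_nil, by rw [map_one, listProd_nil, one_mul], by simp⟩
    exact ⟨a, l, hl, by rw [hk, mul_one]⟩
  induction k using PushoutI.induction_on with
  | of i g => exact fun k' n hk' => ⟨_, hk'.of_mul isLetterLength_zero i g⟩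
  | base b => exact fun k' n hk' => ⟨_, hk'.base_mul isLetterLength_zero b⟩
  | mul x y hx hy =>
    intro k' n hk'
    obtain ⟨n', hyk'⟩ := hy k' n hk'
    simpa only [mul_assoc] using hx _ n' hyk'

theorem exists_wordLength_eq (ℓ₀ : A → ℕ) (ℓ : (Σ i, K i) → ℕ) (k : PushoutI φ) :
    ∃ a l, IsReducedList φ l ∧ base φ a * listProd φ l = k ∧
      wordLength φ ℓ₀ ℓ k = ℓ₀ a + (l.map ℓ).sum := by
  obtain ⟨a, l, hl, hk⟩ := exists_eq_base_mul_listProd k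
  rw [wordLength_eq_sInf]
  exact Nat.sInf_mem (s := {n | ∃ a l, IsReducedList φ l ∧ base φ a * listProd φ l = k ∧
    n = ℓ₀ a + (l.map ℓ).sum}) ⟨_, a, l, hl, hk, rfl⟩

theorem wordLength_le_iff {k : PushoutI φ} {n : ℕ} :
    wordLength φ ℓ₀ ℓ k ≤ n ↔ HasReducedExpression φ ℓ₀ ℓ k n := by
  constructor
  · intro hn
    obtain ⟨a, l, hl, hk, heq⟩ := exists_wordLength_eq ℓ₀ ℓ k
    exact ⟨a, l, hl, hk, heq ▸ hn⟩
  · rintro ⟨a, l, hl, hk, hn⟩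
    rw [wordLength_eq_sInf]
    exact le_trans (Nat.sInf_le (by exact ⟨a, l, hl, hk, rfl⟩)) hn

theorem wordLength_of_mul_le (hℓ : IsLetterLength φ ℓ₀ ℓ) (i : ι) (x : K i) (k : PushoutI φ) :
    wordLength φ ℓ₀ ℓ (of i x * k) ≤ ℓ ⟨i, x⟩ + wordLength φ ℓ₀ ℓ k :=
  wordLength_le_iff.2 ((wordLength_le_iff.1 le_rfl).of_mul hℓ i x)

theorem wordLength_base_mul_le (hℓ : IsLetterLength φ ℓ₀ ℓ) (b : A) (k : PushoutI φ) :
    wordLength φ ℓ₀ ℓ (base φ b * k) ≤ ℓ₀ b + wordLength φ ℓ₀ ℓ k :=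
  wordLength_le_iff.2 ((wordLength_le_iff.1 le_rfl).base_mul hℓ b)

theorem wordLength_one (hℓ : IsLetterLength φ ℓ₀ ℓ) : wordLength φ ℓ₀ ℓ 1 = 0 :=
  Nat.le_zero.1 <| wordLength_le_iff.2 ⟨1, [], isReducedList_nil,
    by rw [map_one, listProd_nil, one_mul],
    by simp [(isLengthFunction_natCast_iff.1 hℓ.base).1]⟩

theorem wordLength_of_le (hℓ : IsLetterLength φ ℓ₀ ℓ) (i : ι) (x : K i) :
    wordLength φ ℓ₀ ℓ (of i x) ≤ ℓ ⟨i, x⟩ := by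
  simpa only [mul_one, wordLength_one hℓ, add_zero] using wordLength_of_mul_le hℓ i x 1

theorem wordLength_base_le (hℓ : IsLetterLength φ ℓ₀ ℓ) (a : A) :
    wordLength φ ℓ₀ ℓ (base φ a) ≤ ℓ₀ a := by
  simpa only [mul_one, wordLength_one hℓ, add_zero] using wordLength_base_mul_le hℓ a 1

theorem wordLength_mul_le (hℓ : IsLetterLength φ ℓ₀ ℓ) (k k' : PushoutI φ) :
    wordLength φ ℓ₀ ℓ (k * k') ≤ wordLength φ ℓ₀ ℓ k + wordLength φ ℓ₀ ℓ k' := by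
  have hlist : ∀ l : List (Σ i, K i),
      wordLength φ ℓ₀ ℓ (listProd φ l * k') ≤ (l.map ℓ).sum + wordLength φ ℓ₀ ℓ k' := by
    intro l
    induction l with
    | nil => simp [listProd_nil]
    | cons s l ih =>
      rw [listProd_cons, mul_assoc, List.map_cons, List.sum_cons, add_assoc]
      exact (wordLength_of_mul_le hℓ _ _ _).trans (Nat.add_le_add_left ih _)
  obtain ⟨a, l, -, rfl, hlen⟩ := exists_wordLength_eq ℓ₀ ℓ k
  rw [hlen, mul_assoc, add_assoc]
  exact (wordLength_base_mul_le hℓ a _).trans (Nat.add_le_add_left (hlist l) _)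

theorem wordLength_inv_le (hℓ : IsLetterLength φ ℓ₀ ℓ) (k : PushoutI φ) :
    wordLength φ ℓ₀ ℓ k⁻¹ ≤ wordLength φ ℓ₀ ℓ k := by
  have hlist : ∀ l : List (Σ i, K i), wordLength φ ℓ₀ ℓ (listProd φ l)⁻¹ ≤ (l.map ℓ).sum := by
    intro l
    induction l with
    | nil => simp [listProd_nil, wordLength_one hℓ]
    | cons s l ih =>
      rw [listProd_cons, mul_inv_rev, List.map_cons, List.sum_cons, add_comm, ← map_inv]
      refine (wordLength_mul_le hℓ _ _).trans (Nat.add_le_add ih ?_)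
      exact (wordLength_of_le hℓ _ _).trans_eq
        ((isLengthFunction_natCast_iff.1 (hℓ.letter s.1)).2.1 s.2)
  obtain ⟨a, l, -, rfl, hlen⟩ := exists_wordLength_eq ℓ₀ ℓ k
  rw [hlen, mul_inv_rev, ← map_inv, add_comm]
  refine (wordLength_mul_le hℓ _ _).trans (Nat.add_le_add (hlist l) ?_)
  exact (wordLength_base_le hℓ _).trans_eq ((isLengthFunction_natCast_iff.1 hℓ.base).2.1 a)

theorem wordLength_inv (hℓ : IsLetterLength φ ℓ₀ ℓ) (k : PushoutI φ) :
    wordLength φ ℓ₀ ℓ k⁻¹ = wordLength φ ℓ₀ ℓ k :=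
  (wordLength_inv_le hℓ k).antisymm (by simpa only [inv_inv] using wordLength_inv_le hℓ k⁻¹)

theorem isLengthFunction_wordLength (hℓ : IsLetterLength φ ℓ₀ ℓ) :
    IsLengthFunction fun k => (wordLength φ ℓ₀ ℓ k : ℝ) :=
  isLengthFunction_natCast_iff.2 ⟨wordLength_one hℓ, wordLength_inv hℓ, wordLength_mul_le hℓ⟩

end WordLength

section SyllableLength

variable {ι A : Type*} {K : ι → Type*} [∀ i, Group (K i)] [Group A] (φ : ∀ i, A →* K i)

open Classical in
/-- The letter length which counts the letters outside the base group. -/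
noncomputable def syllable (s : Σ i, K i) : ℕ := if s.2 ∈ (φ s.1).range then 0 else 1

/-- The number of letters in a reduced expression of an element. -/
noncomputable def syllableLength (k : PushoutI φ) : ℕ := wordLength φ (fun _ => 0) (syllable φ) k

variable {φ}

theorem syllable_of_mem {i : ι} {x : K i} (hx : x ∈ (φ i).range) : syllable φ ⟨i, x⟩ = 0 :=
  if_pos hx

theorem syllable_of_notMem {i : ι} {x : K i} (hx : x ∉ (φ i).range) : syllable φ ⟨i, x⟩ = 1 :=
  if_neg hx

theorem syllable_le_one (s : Σ i, K i) : syllable φ s ≤ 1 := by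
  unfold syllable
  split_ifs <;> simp

theorem syllable_congr {i : ι} {x y : K i} (h : x ∈ (φ i).range ↔ y ∈ (φ i).range) :
    syllable φ ⟨i, x⟩ = syllable φ ⟨i, y⟩ := by
  classical exact if_congr h rfl rfl

theorem isLetterLength_syllable : IsLetterLength φ (fun _ => 0) (syllable φ) where
  base := isLengthFunction_natCast_iff.2 (by simp)
  letter i := by
    refine isLengthFunction_natCast_iff.2 ⟨syllable_of_mem (one_mem _),
      fun x => syllable_congr inv_mem_iff, fun x y => ?_⟩
    by_cases hx : x ∈ (φ i).range
    · rw [syllable_of_mem hx, zero_add]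
      exact (syllable_congr (mul_mem_cancel_left hx)).le
    · rw [syllable_of_notMem hx]
      exact (syllable_le_one _).trans (Nat.le_add_right _ _)
  map_base i a := syllable_of_mem ⟨a, rfl⟩

theorem syllableLength_mul_le (k k' : PushoutI φ) :
    syllableLength φ (k * k') ≤ syllableLength φ k + syllableLength φ k' :=
  wordLength_mul_le isLetterLength_syllable k k'

theorem syllableLength_inv (k : PushoutI φ) : syllableLength φ k⁻¹ = syllableLength φ k :=
  wordLength_inv isLetterLength_syllable k

theorem syllableLength_one : syllableLength φ 1 = 0 := wordLength_one isLetterLength_syllable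

theorem syllableLength_base (a : A) : syllableLength φ (base φ a) = 0 :=
  Nat.le_zero.1 (wordLength_base_le isLetterLength_syllable a)

theorem syllableLength_base_mul (a : A) (k : PushoutI φ) :
    syllableLength φ (base φ a * k) = syllableLength φ k := by
  have hle : ∀ b k, syllableLength φ (base φ b * k) ≤ syllableLength φ k := fun b k => by
    simpa only [syllableLength_base, zero_add] using syllableLength_mul_le (base φ b) k
  refine (hle a k).antisymm ?_
  simpa only [map_inv, inv_mul_cancel_left] using hle a⁻¹ (base φ a * k)

theorem syllableLength_mul_base (k : PushoutI φ) (a : A) :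
    syllableLength φ (k * base φ a) = syllableLength φ k := by
  rw [← syllableLength_inv, mul_inv_rev, ← map_inv, syllableLength_base_mul, syllableLength_inv]

theorem syllableLength_of_le_one (i : ι) (x : K i) : syllableLength φ (of i x) ≤ 1 :=
  (wordLength_of_le isLetterLength_syllable i x).trans (syllable_le_one _)

theorem syllableLength_listProd_le (l : List (Σ i, K i)) :
    syllableLength φ (listProd φ l) ≤ l.length := by
  induction l with
  | nil => exact syllableLength_one.le
  | cons s l ih =>
    rw [listProd_cons, List.length_cons, add_comm]
    exact (syllableLength_mul_le _ _).trans (Nat.add_le_add (syllableLength_of_le_one _ _) ih)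

theorem IsReducedList.exists_normalWord (d : NormalWord.Transversal φ) (a : A)
    {l : List (Σ i, K i)} (hl : IsReducedList φ l) :
    ∃ w : NormalWord d, w.prod = base φ a * listProd φ l ∧ w.toList.length = l.length := by
  obtain ⟨w, rfl, hw⟩ := hl.exists_word
  obtain ⟨w', hprod, hindex⟩ := hw.exists_normalWord_prod_eq d
  refine ⟨a • w', by rw [NormalWord.prod_base_smul, hprod, ofCoprodI_prod], ?_⟩
  have hlen := congrArg List.length hindex
  rwa [List.length_map, List.length_map] at hlen

theorem IsReducedList.length_eq (hφ : ∀ i, Function.Injective (φ i)) {a a' : A}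
    {l l' : List (Σ i, K i)} (hl : IsReducedList φ l) (hl' : IsReducedList φ l')
    (h : base φ a * listProd φ l = base φ a' * listProd φ l') : l.length = l'.length := by
  obtain ⟨d⟩ := NormalWord.transversal_nonempty φ hφ
  obtain ⟨w, hw, hlen⟩ := hl.exists_normalWord d a
  obtain ⟨w', hw', hlen'⟩ := hl'.exists_normalWord d a'
  have heq : w = w' := NormalWord.prod_injective (by rw [hw, hw', h])
  rw [← hlen, ← hlen', heq]

theorem IsReducedList.syllableLength_listProd (hφ : ∀ i, Function.Injective (φ i))
    {l : List (Σ i, K i)} (hl : IsReducedList φ l) :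
    syllableLength φ (listProd φ l) = l.length := by
  obtain ⟨a, m, hm, hprod, hlen⟩ :=
    exists_wordLength_eq (fun _ : A => 0) (syllable φ) (listProd φ l)
  have hcount : (m.map (syllable φ)).sum = m.length := by
    rw [List.map_congr_left fun s hs => syllable_of_notMem (hm.1 s hs)]
    simp
  rw [syllableLength, hlen, hcount, zero_add]
  exact hm.length_eq hφ hl (a' := 1) (by rw [hprod, map_one, one_mul])

theorem IsReducedList.syllableLength_base_mul (hφ : ∀ i, Function.Injective (φ i)) (a : A)
    {l : List (Σ i, K i)} (hl : IsReducedList φ l) :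
    syllableLength φ (base φ a * listProd φ l) = l.length := by
  rw [_root_.syllableLength_base_mul, hl.syllableLength_listProd hφ]

theorem isReducedList_of_length_le {l : List (Σ i, K i)}
    (h : l.length ≤ syllableLength φ (listProd φ l)) : IsReducedList φ l := by
  induction l with
  | nil => exact isReducedList_nil
  | cons s l ih =>
    rw [listProd_cons, List.length_cons] at h
    have hle := h.trans (syllableLength_mul_le _ _)
    have hs := syllableLength_of_le_one (φ := φ) s.1 s.2
    refine isReducedList_cons.2 ⟨?_, ?_, ih (by omega)⟩
    · rintro ⟨a, ha⟩
      rw [← ha, of_apply_eq_base, syllableLength_base_mul] at h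
      exact absurd (h.trans (syllableLength_listProd_le l)) (by omega)
    · obtain ⟨i, x⟩ := s
      rintro ⟨j, y⟩ hy (rfl : i = j)
      obtain ⟨m, rfl⟩ : ∃ m, l = ⟨i, y⟩ :: m := by
        cases l with
        | nil => simp at hy
        | cons t m => exact ⟨m, by simpa using hy⟩
      rw [listProd_cons, ← mul_assoc, ← map_mul, List.length_cons] at h
      change m.length + 1 + 1 ≤ syllableLength φ (of i (x * y) * listProd φ m) at h
      have := h.trans (syllableLength_mul_le _ _)
      have := syllableLength_of_le_one (φ := φ) i (x * y)
      have := syllableLength_listProd_le (φ := φ) m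
      omega

theorem syllableLength_eq_zero_iff (hφ : ∀ i, Function.Injective (φ i)) {k : PushoutI φ} :
    syllableLength φ k = 0 ↔ k ∈ (base φ).range := by
  constructor
  · intro hk
    obtain ⟨a, l, hl, rfl⟩ := exists_eq_base_mul_listProd k
    rw [hl.syllableLength_base_mul hφ, List.length_eq_zero_iff] at hk
    exact ⟨a, by rw [hk, listProd_nil, mul_one]⟩
  · rintro ⟨a, rfl⟩
    exact syllableLength_base a

theorem of_mem_range_base_iff (hφ : ∀ i, Function.Injective (φ i)) {i : ι} {x : K i} :
    (of i x : PushoutI φ) ∈ (base φ).range ↔ x ∈ (φ i).range := by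
  constructor
  · rintro ⟨a, ha⟩
    exact ⟨a, of_injective hφ i (by rw [of_apply_eq_base, ha])⟩
  · rintro ⟨a, rfl⟩
    exact ⟨a, (of_apply_eq_base φ i a).symm⟩

theorem syllableLength_of (hφ : ∀ i, Function.Injective (φ i)) {i : ι} {x : K i}
    (hx : x ∉ (φ i).range) : syllableLength φ (of i x) = 1 := by
  refine (syllableLength_of_le_one i x).antisymm (Nat.one_le_iff_ne_zero.2 fun hzero => hx ?_)
  rwa [← of_mem_range_base_iff hφ, ← syllableLength_eq_zero_iff hφ]

theorem index_eq_of_of_eq (hφ : ∀ i, Function.Injective (φ i)) {i j : ι} {x : K i} {y : K j}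
    (hx : x ∉ (φ i).range) (h : (of i x : PushoutI φ) = of j y) : i = j := by
  by_contra hij
  refine hx ((of_mem_range_base_iff hφ).1 ?_)
  rw [← inf_of_range_eq_base_range hφ hij]
  exact ⟨⟨x, rfl⟩, ⟨y, h.symm⟩⟩

theorem exists_eq_listProd (hφ : ∀ i, Function.Injective (φ i)) {k : PushoutI φ}
    (hk : syllableLength φ k ≠ 0) : ∃ l, IsReducedList φ l ∧ listProd φ l = k := by
  obtain ⟨a, l, hl, rfl⟩ := exists_eq_base_mul_listProd k
  rw [hl.syllableLength_base_mul hφ] at hk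
  cases l with
  | nil => exact absurd rfl hk
  | cons s l =>
    obtain ⟨hs, hhead, htail⟩ := isReducedList_cons.1 hl
    refine ⟨⟨s.1, φ s.1 a * s.2⟩ :: l, isReducedList_cons.2 ⟨?_, hhead, htail⟩, ?_⟩
    · rwa [mul_mem_cancel_left (MonoidHom.mem_range.2 ⟨a, rfl⟩)]
    · simp only [listProd_cons, map_mul, of_apply_eq_base, mul_assoc]

theorem IsReducedList.take {l : List (Σ i, K i)} (hl : IsReducedList φ l) (n : ℕ) :
    IsReducedList φ (l.take n) :=
  ⟨fun s hs => hl.1 s (List.mem_of_mem_take hs), hl.2.take n⟩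

theorem isReducedList_append {l m : List (Σ i, K i)} :
    IsReducedList φ (l ++ m) ↔ IsReducedList φ l ∧ IsReducedList φ m ∧
      ∀ s ∈ l.getLast?, ∀ t ∈ m.head?, s.1 ≠ t.1 := by
  simp only [IsReducedList, List.forall_mem_append, List.isChain_append]
  tauto

theorem IsReducedList.exists_tail_eq (hφ : ∀ i, Function.Injective (φ i)) {a a' : A}
    {s s' : Σ i, K i} {l l' : List (Σ i, K i)} (hl : IsReducedList φ (s :: l))
    (hl' : IsReducedList φ (s' :: l'))
    (h : base φ a * listProd φ (s :: l) = base φ a' * listProd φ (s' :: l')) :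
    ∃ b, listProd φ l' = base φ b * listProd φ l := by
  have hlen : l'.length = l.length := by simpa using (hl.length_eq hφ hl' h).symm
  obtain ⟨hs, hhead, htail⟩ := isReducedList_cons.1 hl
  obtain ⟨hs', -, htail'⟩ := isReducedList_cons.1 hl'
  obtain ⟨i, x⟩ := s
  obtain ⟨j, y⟩ := s'
  have hprod : listProd φ l' =
      of j (y⁻¹ * φ j (a'⁻¹ * a)) * (of i x * listProd φ l) := by
    rw [listProd_cons, listProd_cons] at h
    rw [map_mul, of_apply_eq_base, map_inv, map_mul, map_inv, mul_assoc, mul_assoc, h,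
      inv_mul_cancel_left, inv_mul_cancel_left]
  -- A product on the right which did not collapse would have the wrong syllable length.
  have hnot : ∀ m, IsReducedList φ m → listProd φ m = listProd φ l' → m.length = l.length :=
    fun m hm heq => by
      rw [← hm.syllableLength_listProd hφ, heq, htail'.syllableLength_listProd hφ, hlen]
  by_cases hij : j = i
  · subst hij
    rw [← mul_assoc, ← map_mul] at hprod
    by_cases hbase : y⁻¹ * φ j (a'⁻¹ * a) * x ∈ (φ j).range
    · obtain ⟨b, hb⟩ := hbase
      exact ⟨b, by rw [hprod, ← hb, of_apply_eq_base]⟩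
    · have := hnot (⟨j, _⟩ :: l) (isReducedList_cons.2 ⟨hbase, hhead, htail⟩)
        (by rw [hprod, listProd_cons])
      simp at this
  · have := hnot (⟨j, _⟩ :: ⟨i, x⟩ :: l) (isReducedList_cons.2
      ⟨(mul_mem_cancel_right (MonoidHom.mem_range.2 ⟨_, rfl⟩)).not.2 (inv_mem_iff.not.2 hs'),
        by simpa using hij, hl⟩) (by rw [hprod, listProd_cons, listProd_cons])
    simp only [List.length_cons] at this
    omega

theorem IsReducedList.exists_drop_eq (hφ : ∀ i, Function.Injective (φ i)) {a a' : A}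
    {l l' : List (Σ i, K i)} (hl : IsReducedList φ l) (hl' : IsReducedList φ l')
    (h : base φ a * listProd φ l = base φ a' * listProd φ l') (n : ℕ) :
    ∃ b, listProd φ (l'.drop n) = base φ b * listProd φ (l.drop n) := by
  induction n generalizing a a' l l' with
  | zero =>
    exact ⟨a'⁻¹ * a, by
      rw [map_mul, mul_assoc, List.drop_zero, List.drop_zero, h, map_inv, inv_mul_cancel_left]⟩
  | succ n ih =>
    have hlen := hl.length_eq hφ hl' h
    match l, l' with
    | [], [] => exact ⟨1, by simp [listProd_nil]⟩
    | s :: l, s' :: l' =>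
      obtain ⟨b, hb⟩ := hl.exists_tail_eq hφ hl' h
      exact ih (isReducedList_cons.1 hl).2.2 (isReducedList_cons.1 hl').2.2
        (a := b) (a' := 1) (by rw [hb, map_one, one_mul])

theorem exists_reducedList_append (hφ : ∀ i, Function.Injective (φ i)) {y v : PushoutI φ}
    (h : syllableLength φ (y * v) = syllableLength φ y + syllableLength φ v)
    (hv : syllableLength φ v ≠ 0) :
    ∃ a l m, IsReducedList φ (l ++ m) ∧ base φ a * listProd φ l = y ∧ listProd φ m = v ∧
      l.length = syllableLength φ y := by
  obtain ⟨a, l, hl, rfl⟩ := exists_eq_base_mul_listProd y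
  obtain ⟨m, hm, rfl⟩ := exists_eq_listProd hφ hv
  refine ⟨a, l, m, isReducedList_of_length_le ?_, rfl, rfl, (hl.syllableLength_base_mul hφ a).symm⟩
  rw [mul_assoc, ← listProd_append, _root_.syllableLength_base_mul, hl.syllableLength_base_mul hφ,
    hm.syllableLength_listProd hφ] at h
  rw [h, List.length_append]

theorem mul_inv_mem_range_base (hφ : ∀ i, Function.Injective (φ i)) {y v y' v' : PushoutI φ}
    (h : syllableLength φ (y * v) = syllableLength φ y + syllableLength φ v)
    (h' : syllableLength φ (y' * v') = syllableLength φ y' + syllableLength φ v')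
    (heq : y * v = y' * v') (hlen : syllableLength φ v = syllableLength φ v') :
    v' * v⁻¹ ∈ (base φ).range := by
  by_cases hv : syllableLength φ v = 0
  · exact mul_mem ((syllableLength_eq_zero_iff hφ).1 (hlen ▸ hv))
      (inv_mem ((syllableLength_eq_zero_iff hφ).1 hv))
  obtain ⟨a, l, m, hred, rfl, rfl, hl⟩ := exists_reducedList_append hφ h hv
  obtain ⟨a', l', m', hred', rfl, rfl, hl'⟩ := exists_reducedList_append hφ h' (hlen ▸ hv)
  rw [mul_assoc, mul_assoc, ← listProd_append, ← listProd_append] at heq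
  obtain ⟨b, hb⟩ := hred.exists_drop_eq hφ hred' heq l.length
  have hll' : l.length = l'.length := by
    have := congrArg (syllableLength φ) heq
    simp only [listProd_append, ← mul_assoc, h, h'] at this
    omega
  rw [List.drop_left, hll', List.drop_left] at hb
  exact ⟨b, by rw [hb, mul_inv_cancel_right]⟩

theorem syllableLength_mul_eq_or_exists (hφ : ∀ i, Function.Injective (φ i)) (y z : PushoutI φ) :
    syllableLength φ (y * z) = syllableLength φ y + syllableLength φ z ∨
      ∃ (i : ι) (g h : K i) (y₁ z₁ : PushoutI φ), g ∉ (φ i).range ∧ h ∉ (φ i).range ∧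
        y = y₁ * of i g ∧ z = of i h * z₁ ∧ syllableLength φ y = syllableLength φ y₁ + 1 ∧
        syllableLength φ z = syllableLength φ z₁ + 1 ∧ (g * h ∉ (φ i).range →
          syllableLength φ (y₁ * of i (g * h) * z₁) =
            syllableLength φ y₁ + 1 + syllableLength φ z₁) := by
  by_cases hy : syllableLength φ y = 0
  · obtain ⟨a, rfl⟩ := (syllableLength_eq_zero_iff hφ).1 hy
    exact .inl (by rw [syllableLength_base_mul, hy, zero_add])
  by_cases hz : syllableLength φ z = 0
  · obtain ⟨a, rfl⟩ := (syllableLength_eq_zero_iff hφ).1 hz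
    exact .inl (by rw [syllableLength_mul_base, hz, add_zero])
  obtain ⟨l, hl, rfl⟩ := exists_eq_listProd hφ hy
  obtain ⟨m, hm, rfl⟩ := exists_eq_listProd hφ hz
  rw [hl.syllableLength_listProd hφ] at hy ⊢
  rw [hm.syllableLength_listProd hφ] at hz ⊢
  obtain ⟨l, ⟨i, g⟩, rfl⟩ :=
    (List.eq_nil_or_concat' l).resolve_left (List.length_eq_zero_iff.not.1 hy)
  obtain ⟨⟨j, h⟩, m, rfl⟩ := List.exists_cons_of_ne_nil (List.length_eq_zero_iff.not.1 hz)
  by_cases hij : i = j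
  · subst hij
    obtain ⟨hl₀, hg, hlast⟩ := isReducedList_append.1 hl
    obtain ⟨hh, hhead, hm₀⟩ := isReducedList_cons.1 hm
    refine .inr ⟨i, g, h, listProd φ l, listProd φ m, (isReducedList_cons.1 hg).1, hh,
      by simp [listProd_append, listProd_cons, listProd_nil], listProd_cons _ _,
      by rw [hl₀.syllableLength_listProd hφ]; simp,
      by rw [hm₀.syllableLength_listProd hφ]; simp, fun hgh => ?_⟩
    have hred : IsReducedList φ (l ++ ⟨i, g * h⟩ :: m) :=
      isReducedList_append.2 ⟨hl₀, isReducedList_cons.2 ⟨hgh, hhead, hm₀⟩, by simpa using hlast⟩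
    have := hred.syllableLength_listProd hφ
    rw [listProd_append, listProd_cons, ← mul_assoc] at this
    rw [this, hl₀.syllableLength_listProd hφ, hm₀.syllableLength_listProd hφ, List.length_append,
      List.length_cons, add_assoc, add_comm 1]
  · left
    rw [← listProd_append, ← List.length_append]
    exact (isReducedList_append.2 ⟨hl, hm, by simpa using hij⟩).syllableLength_listProd hφ

variable {ℓ₀ : A → ℕ} {ℓ : (Σ i, K i) → ℕ}

theorem wordLength_base_mul_listProd_le {l : List (Σ i, K i)} (hl : IsReducedList φ l) (a : A) :
    wordLength φ ℓ₀ ℓ (base φ a * listProd φ l) ≤ ℓ₀ a + (l.map ℓ).sum :=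
  wordLength_le_iff.2 ⟨a, l, hl, rfl, le_rfl⟩

theorem exists_wordLength_mul_base_add_le (hφ : ∀ i, Function.Injective (φ i))
    (hℓ₀ : ℓ₀ 1 = 0) {y v : PushoutI φ}
    (h : syllableLength φ (y * v) = syllableLength φ y + syllableLength φ v) :
    ∃ b, wordLength φ ℓ₀ ℓ (y * base φ b) + wordLength φ ℓ₀ ℓ ((base φ b)⁻¹ * v) ≤
      wordLength φ ℓ₀ ℓ (y * v) := by
  obtain ⟨a, l, hl, hprod, hlen⟩ := exists_wordLength_eq ℓ₀ ℓ (y * v)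
  set n := syllableLength φ y
  have htake := hl.take n
  have hdrop := hl.drop n
  have hsplit : listProd φ l = listProd φ (l.take n) * listProd φ (l.drop n) := by
    rw [← listProd_append, List.take_append_drop]
  have hlength : l.length = n + syllableLength φ v := by
    rw [← h, ← hprod, hl.syllableLength_base_mul hφ]
  rw [hsplit, ← mul_assoc] at hprod
  obtain ⟨c, hc⟩ := mul_inv_mem_range_base hφ h (y' := base φ a * listProd φ (l.take n))
    (v' := listProd φ (l.drop n))
    (by rw [hprod, h, htake.syllableLength_base_mul hφ, hdrop.syllableLength_listProd hφ,
      List.length_take, List.length_drop]; omega) hprod.symm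
    (by rw [hdrop.syllableLength_listProd hφ, List.length_drop]; omega)
  have hv : base φ c * v = listProd φ (l.drop n) := by rw [hc, inv_mul_cancel_right]
  have hy : y * base φ c⁻¹ = base φ a * listProd φ (l.take n) := by
    rw [← hv, ← mul_assoc, mul_left_inj] at hprod
    rw [← hprod, map_inv, mul_inv_cancel_right]
  have hle_y := wordLength_base_mul_listProd_le (ℓ₀ := ℓ₀) (ℓ := ℓ) htake a
  have hle_v := wordLength_base_mul_listProd_le (ℓ₀ := ℓ₀) (ℓ := ℓ) hdrop 1
  rw [map_one, one_mul, hℓ₀, zero_add] at hle_v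
  refine ⟨c⁻¹, ?_⟩
  rw [hy, map_inv, inv_inv, hv, hlen, ← List.sum_take_add_sum_drop (l.map ℓ) n, ← List.map_take,
    ← List.map_drop, ← add_assoc]
  exact Nat.add_le_add hle_y hle_v

theorem IsLetterLength.le_wordLength_of (hℓ : IsLetterLength φ ℓ₀ ℓ)
    (hφ : ∀ i, Function.Injective (φ i)) (i : ι) (x : K i) :
    ℓ ⟨i, x⟩ ≤ wordLength φ ℓ₀ ℓ (of i x) := by
  obtain ⟨a, l, hl, hprod, hlen⟩ := exists_wordLength_eq ℓ₀ ℓ (of i x : PushoutI φ)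
  rw [hlen]
  match l with
  | [] =>
    rw [listProd_nil, mul_one, ← of_apply_eq_base φ i] at hprod
    simp [← of_injective hφ i hprod, hℓ.map_base]
  | [⟨j, y⟩] =>
    rw [listProd_cons, listProd_nil, mul_one, ← of_apply_eq_base φ j, ← map_mul] at hprod
    have hy : φ j a * y ∉ (φ j).range :=
      (mul_mem_cancel_left (MonoidHom.mem_range.2 ⟨a, rfl⟩)).not.2 (isReducedList_cons.1 hl).1
    obtain rfl := index_eq_of_of_eq hφ hy hprod
    have := (isLengthFunction_natCast_iff.1 (hℓ.letter j)).2.2 (φ j a) y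
    rw [hℓ.map_base] at this
    simpa [← of_injective hφ j hprod] using this
  | s :: t :: l =>
    have := syllableLength_of_le_one (φ := φ) i x
    rw [← hprod, hl.syllableLength_base_mul hφ] at this
    simp at this

theorem syllableLength_le_wordLength (hℓ : ∀ i, ∀ x ∉ (φ i).range, ℓ ⟨i, x⟩ ≠ 0)
    (k : PushoutI φ) : syllableLength φ k ≤ wordLength φ ℓ₀ ℓ k := by
  obtain ⟨a, l, hl, rfl, hlen⟩ := exists_wordLength_eq ℓ₀ ℓ k
  rw [hlen, syllableLength_base_mul]
  refine (syllableLength_listProd_le l).trans (le_add_left ?_)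
  have := List.card_nsmul_le_sum (l.map ℓ) 1 fun n hn => by
    obtain ⟨s, hs, rfl⟩ := List.mem_map.1 hn
    exact Nat.one_le_iff_ne_zero.2 (hℓ s.1 s.2 (hl.1 s hs))
  simpa using this

end SyllableLength

theorem exists_minimal_section {G : Type*} [Group G] (B : Subgroup G) (L : G → ℕ) :
    ∃ ρ : G ⧸ B → G, (∀ x, (ρ x : G ⧸ B) = x) ∧ ∀ g : G, L (ρ g) ≤ L g := by
  have h : ∀ x : G ⧸ B, ∃ g : G, (g : G ⧸ B) = x ∧ ∀ g' : G, (g' : G ⧸ B) = x → L g ≤ L g' := by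
    intro x
    have hne : {g : G | (g : G ⧸ B) = x}.Nonempty := QuotientGroup.mk_surjective x
    exact ⟨Function.argminOn L _ hne, Function.argminOn_mem L _ hne,
      fun g' hg' => Function.argminOn_le L _ hg'⟩
  choose ρ hρ hmin using h
  exact ⟨ρ, hρ, fun g => hmin g g rfl⟩

section Blocks

variable {ι A : Type*} {K : ι → Type*} [∀ i, Group (K i)] [Group A] {φ : ∀ i, A →* K i}

variable (φ) in
/-- There is no cancellation in the product `u k w⁻¹`: its syllable length is the sum of those of
the three factors. -/
def IsBlock (u k w : PushoutI φ) : Prop :=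
  syllableLength φ (u * k * w⁻¹) = syllableLength φ u + syllableLength φ k + syllableLength φ w

theorem IsBlock.symm {u k w : PushoutI φ} (h : IsBlock φ u k w) : IsBlock φ w k⁻¹ u := by
  rw [IsBlock, ← syllableLength_inv]
  simp only [mul_inv_rev, inv_inv, syllableLength_inv, ← mul_assoc]
  rw [h]
  ring

theorem IsBlock.syllableLength_mul {u k w : PushoutI φ} (h : IsBlock φ u k w) :
    syllableLength φ (u * k) = syllableLength φ u + syllableLength φ k := by
  have := syllableLength_mul_le (u * k) w⁻¹
  have := syllableLength_mul_le u k
  rw [IsBlock] at h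
  rw [syllableLength_inv] at *
  omega

theorem IsBlock.syllableLength_mul_inv {u k w : PushoutI φ} (h : IsBlock φ u k w) :
    syllableLength φ (u * k * w⁻¹) = syllableLength φ (u * k) + syllableLength φ w⁻¹ := by
  rw [h.syllableLength_mul, syllableLength_inv, h]

theorem IsBlock.inv_mul_mem (hφ : ∀ i, Function.Injective (φ i)) {u k w u' k' w' : PushoutI φ}
    (h : IsBlock φ u k w) (h' : IsBlock φ u' k' w') (heq : u * k * w⁻¹ = u' * k' * w'⁻¹)
    (hlen : syllableLength φ w = syllableLength φ w') : w⁻¹ * w' ∈ (base φ).range := by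
  have := inv_mem (mul_inv_mem_range_base hφ h.syllableLength_mul_inv h'.syllableLength_mul_inv heq
    (by rw [syllableLength_inv, syllableLength_inv, hlen]))
  simpa using this

theorem exists_isBlock_triangle (hφ : ∀ i, Function.Injective (φ i)) (i₀ : ι) (y z : PushoutI φ) :
    ∃ (i : ι) (u v w : PushoutI φ) (g h : K i), u * of i g * v⁻¹ = y ∧ v * of i h * w⁻¹ = z ∧
      IsBlock φ u (of i g) v ∧ IsBlock φ v (of i h) w ∧ IsBlock φ u (of i (g * h)) w ∧
      syllableLength φ (of i g) = syllableLength φ (of i (g * h)) ∧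
      syllableLength φ (of i h) = syllableLength φ (of i (g * h)) ∧
      (syllableLength φ (of i (g * h)) = 0 → i = i₀) := by
  induction hn : syllableLength φ y using Nat.strong_induction_on generalizing y z with
  | h n ih =>
  subst hn
  rcases syllableLength_mul_eq_or_exists hφ y z with
    hyz | ⟨i, g, h, y₁, z₁, hg, hh, rfl, rfl, hy, hz, hgh⟩
  · refine ⟨i₀, y, 1, z⁻¹, 1, 1, by simp, by simp, ?_⟩
    simp [IsBlock, syllableLength_one, syllableLength_inv, hyz]
  by_cases hmem : g * h ∈ (φ i).range
  · -- `g h` is absorbed into the base group, and `g` extends the leg `v` of a shorter tripod.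
    obtain ⟨c, hc⟩ := hmem
    obtain ⟨i', u, v, w, g', h', hyv, hzw, hug, hvh, huw, hlen⟩ :=
      ih _ (by omega) y₁ (base φ c * z₁) rfl
    have hyv' : u * of i' g' * ((of i g)⁻¹ * v)⁻¹ = y₁ * of i g := by
      rw [← hyv, mul_inv_rev, inv_inv, mul_assoc (u * of i' g')]
    have hzw' : (of i g)⁻¹ * v * of i' h' * w⁻¹ = of i h * z₁ := by
      rw [mul_assoc, mul_assoc, ← mul_assoc v, hzw, ← of_apply_eq_base φ i, hc, map_mul,
        mul_assoc, inv_mul_cancel_left]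
    have hv : syllableLength φ ((of i g)⁻¹ * v) = syllableLength φ v + 1 := by
      have hle := syllableLength_mul_le (of i g)⁻¹ v
      have hle' := syllableLength_mul_le (u * of i' g') ((of i g)⁻¹ * v)⁻¹
      have hle'' := syllableLength_mul_le u (of i' g')
      have hle_one := syllableLength_of_le_one (φ := φ) i g
      rw [IsBlock, hyv] at hug
      rw [syllableLength_inv] at hle
      rw [hyv', syllableLength_inv] at hle'
      omega
    refine ⟨i', u, _, w, g', h', hyv', hzw', ?_, ?_, huw, hlen⟩
    · rw [IsBlock, hyv', hy, hv, ← hyv, hug, add_assoc]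
    · rw [IsBlock, hzw', hz, hv, ← syllableLength_base_mul c, ← hzw, hvh]
      ring
  · have hone := syllableLength_of hφ hmem
    refine ⟨i, y₁, 1, z₁⁻¹, g, h, by simp, by simp, ?_⟩
    simp only [IsBlock, syllableLength_one, syllableLength_inv, inv_inv, inv_one, mul_one, one_mul,
      hy, hz, hgh hmem, hone, syllableLength_of hφ hg, syllableLength_of hφ hh]
    simp [add_comm]

variable {ℓ₀ : A → ℕ} {ℓ : (Σ i, K i) → ℕ}

variable (φ) in
/-- The left cosets of the base group in the amalgamated product. -/
abbrev BaseCoset : Type _ := PushoutI φ ⧸ (base φ).range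

variable (φ) in
/-- Two-sided coset coordinates on the amalgamated product: a letter and two cosets, whose
representatives under a section `ρ` surround it. -/
abbrev BlockIndex : Type _ := Σ i, (BaseCoset φ × BaseCoset φ) × K i

/-- The element of the amalgamated product with the given coset coordinates. -/
def blockProd (ρ : BaseCoset φ → PushoutI φ) (t : BlockIndex φ) : PushoutI φ :=
  ρ t.2.1.1 * of t.1 t.2.2 * (ρ t.2.1.2)⁻¹

/-- The coordinates without cancellation whose letter is at level `m`. The level of a letter `s`
after `u` is `2 |u| + |s|`, so that it determines both `|u|` and `|s| ≤ 1`. An element of the base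
group is a letter of every factor; only the factor `i₀` is used for it. -/
def blockSet (i₀ : ι) (ρ : BaseCoset φ → PushoutI φ) (m : ℕ) :
    Set (BlockIndex φ) :=
  {t | IsBlock φ (ρ t.2.1.1) (of t.1 t.2.2) (ρ t.2.1.2) ∧
    2 * syllableLength φ (ρ t.2.1.1) + syllableLength φ (of t.1 t.2.2) = m ∧
    (syllableLength φ (of t.1 t.2.2) = 0 → t.1 = i₀)}

/-- The function `θ` in the coset coordinates of level `m`: for each factor and each pair of
cosets, a function on the factor. -/
noncomputable def blockMatrix (i₀ : ι) (ρ : BaseCoset φ → PushoutI φ) (m : ℕ)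
    (θ : PushoutI φ → ℝ≥0∞) : BlockIndex φ → ℝ≥0∞ :=
  (blockSet i₀ ρ m).indicator fun t => θ (blockProd ρ t)

variable {ρ : BaseCoset φ → PushoutI φ} {i₀ : ι}

theorem injOn_blockProd (hφ : ∀ i, Function.Injective (φ i))
    (hρ : ∀ x, (ρ x : BaseCoset φ) = x) (m : ℕ) :
    (blockSet i₀ ρ m).InjOn (blockProd ρ) := by
  rintro ⟨i, ⟨x, y⟩, s⟩ ⟨hblock, hm, hi⟩ ⟨i', ⟨x', y'⟩, s'⟩ ⟨hblock', hm', hi'⟩ heq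
  simp only [blockProd] at heq hblock hblock' hm hm' hi hi'
  have hs := syllableLength_of_le_one (φ := φ) i s
  have hs' := syllableLength_of_le_one (φ := φ) i' s'
  have hy : y = y' := by
    rw [← hρ y, ← hρ y', QuotientGroup.eq]
    have hlen := congrArg (syllableLength φ) heq
    rw [hblock, hblock'] at hlen
    exact hblock.inv_mul_mem hφ hblock' heq (by omega)
  have hx : x = x' := by
    rw [← hρ x, ← hρ x', QuotientGroup.eq]
    refine hblock.symm.inv_mul_mem hφ hblock'.symm ?_ (by omega)
    simpa only [mul_inv_rev, inv_inv, ← mul_assoc] using congrArg (·⁻¹) heq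
  subst hx hy
  rw [mul_left_inj, mul_right_inj] at heq
  have hindex : i = i' := by
    by_cases hmem : s ∈ (φ i).range
    · have hzero : syllableLength φ (of i s) = 0 :=
        (syllableLength_eq_zero_iff hφ).2 ((of_mem_range_base_iff hφ).2 hmem)
      rw [hi hzero, hi' (heq ▸ hzero)]
    · exact index_eq_of_of_eq hφ hmem heq
  subst hindex
  rw [of_injective hφ i heq]

theorem ellTwoNorm_blockMatrix_le (hφ : ∀ i, Function.Injective (φ i))
    (hρ : ∀ x, (ρ x : BaseCoset φ) = x) (m : ℕ) (θ : PushoutI φ → ℝ≥0∞) :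
    ellTwoNorm (blockMatrix i₀ ρ m θ) ≤ ellTwoNorm θ :=
  ellTwoNorm_indicator_comp_le (injOn_blockProd hφ hρ m) θ

theorem IsBlock.letterLength_le (hφ : ∀ i, Function.Injective (φ i)) (hℓ : IsLetterLength φ ℓ₀ ℓ)
    {u w : PushoutI φ} {i : ι} {s : K i} (h : IsBlock φ u (of i s) w)
    (hu : ∀ a, wordLength φ ℓ₀ ℓ u ≤ wordLength φ ℓ₀ ℓ (u * base φ a))
    (hw : ∀ a, wordLength φ ℓ₀ ℓ w ≤ wordLength φ ℓ₀ ℓ (w * base φ a)) :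
    ℓ ⟨i, s⟩ ≤ 2 * wordLength φ ℓ₀ ℓ (u * of i s * w⁻¹) := by
  set y := u * of i s * w⁻¹
  have hone := (isLengthFunction_natCast_iff.1 hℓ.base).1
  obtain ⟨b, hb⟩ := exists_wordLength_mul_base_add_le (ℓ := ℓ) hφ hone h.syllableLength_mul_inv
  obtain ⟨a, ha⟩ : ∃ a, wordLength φ ℓ₀ ℓ (u * base φ a) ≤
      wordLength φ ℓ₀ ℓ (u * of i s * base φ b) := by
    obtain ⟨a, ha⟩ := exists_wordLength_mul_base_add_le (ℓ₀ := ℓ₀) (ℓ := ℓ) (y := u)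
      (v := of i s * base φ b) hφ hone (by
        rw [← mul_assoc, syllableLength_mul_base, syllableLength_mul_base, h.syllableLength_mul])
    rw [← mul_assoc u] at ha
    exact ⟨a, le_of_add_le_left ha⟩
  have hcancel : wordLength φ ℓ₀ ℓ u + wordLength φ ℓ₀ ℓ w ≤ wordLength φ ℓ₀ ℓ y := by
    refine (Nat.add_le_add ((hu a).trans ha) (hw b)).trans ?_
    rwa [← wordLength_inv hℓ (w * base φ b), mul_inv_rev]
  calc ℓ ⟨i, s⟩ ≤ wordLength φ ℓ₀ ℓ (of i s) := hℓ.le_wordLength_of hφ i s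
    _ = wordLength φ ℓ₀ ℓ (u⁻¹ * y * w) := by
      simp only [y, mul_assoc, inv_mul_cancel_left, inv_mul_cancel, mul_one]
    _ ≤ wordLength φ ℓ₀ ℓ u + wordLength φ ℓ₀ ℓ y + wordLength φ ℓ₀ ℓ w := by
      refine (wordLength_mul_le hℓ _ _).trans (Nat.add_le_add_right ?_ _)
      exact (wordLength_mul_le hℓ _ _).trans_eq (by rw [wordLength_inv hℓ])
    _ ≤ 2 * wordLength φ ℓ₀ ℓ y := by omega

theorem blockProd_base_change {i : ι} {u v : PushoutI φ} {a b : A}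
    {x y : BaseCoset φ} (hx : ρ x = u * base φ a) (hy : ρ y = v * base φ b)
    (g : K i) : blockProd ρ ⟨i, (x, y), (φ i a)⁻¹ * g * φ i b⟩ = u * of i g * v⁻¹ := by
  simp only [blockProd, hx, hy, map_mul, map_inv, of_apply_eq_base, mul_inv_rev, mul_assoc,
    mul_inv_cancel_left]

theorem base_change_mem_blockSet {i : ι} {u v : PushoutI φ} {a b : A}
    {x y : BaseCoset φ} (hx : ρ x = u * base φ a) (hy : ρ y = v * base φ b)
    {g : K i} (hblock : IsBlock φ u (of i g) v) (hi : syllableLength φ (of i g) = 0 → i = i₀) :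
    (⟨i, (x, y), (φ i a)⁻¹ * g * φ i b⟩ : BlockIndex φ) ∈
      blockSet i₀ ρ (2 * syllableLength φ u + syllableLength φ (of i g)) := by
  have hlen : syllableLength φ (of i ((φ i a)⁻¹ * g * φ i b)) = syllableLength φ (of i g) := by
    rw [map_mul, map_mul, ← map_inv, of_apply_eq_base, of_apply_eq_base, syllableLength_mul_base,
      syllableLength_base_mul]
  refine ⟨?_, by simp only [hx, syllableLength_mul_base, hlen], by simpa only [hlen] using hi⟩
  have hprod := blockProd_base_change hx hy g
  rw [blockProd] at hprod
  rw [IsBlock, hprod, hblock, hlen, hx, hy, syllableLength_mul_base, syllableLength_mul_base]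

theorem exists_blockSet_triangle (hφ : ∀ i, Function.Injective (φ i))
    (hρ : ∀ x, (ρ x : BaseCoset φ) = x) (i₀ : ι) (y z : PushoutI φ) :
    ∃ (i : ι) (x₁ x₂ x₃ : BaseCoset φ) (s t : K i) (m m' : ℕ),
      blockProd ρ ⟨i, (x₁, x₂), s⟩ = y ∧ blockProd ρ ⟨i, (x₂, x₃), t⟩ = z ∧
      ⟨i, (x₁, x₂), s⟩ ∈ blockSet i₀ ρ m ∧ ⟨i, (x₂, x₃), t⟩ ∈ blockSet i₀ ρ m' ∧
      ⟨i, (x₁, x₃), s * t⟩ ∈ blockSet i₀ ρ m ∧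
      m ≤ 2 * syllableLength φ y ∧ m' ≤ 2 * syllableLength φ y := by
  obtain ⟨i, u, v, w, g, h, hy, hz, hug, hvh, huw, hlen, hlen', hi⟩ :=
    exists_isBlock_triangle hφ i₀ y z
  have hrep : ∀ u : PushoutI φ, ∃ a, ρ u = u * base φ a := fun u => by
    obtain ⟨a, ha⟩ := QuotientGroup.eq.1 (hρ u).symm
    exact ⟨a, by rw [ha, mul_inv_cancel_left]⟩
  obtain ⟨a, ha⟩ := hrep u
  obtain ⟨b, hb⟩ := hrep v
  obtain ⟨c, hc⟩ := hrep w
  have hmul : (φ i a)⁻¹ * g * φ i b * ((φ i b)⁻¹ * h * φ i c) = (φ i a)⁻¹ * (g * h) * φ i c := by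
    group
  rw [← hlen] at hi
  have hsum := hug
  rw [IsBlock, hy] at hsum
  refine ⟨i, u, v, w, _, _, _, _, (blockProd_base_change ha hb g).trans hy,
    (blockProd_base_change hb hc h).trans hz, base_change_mem_blockSet ha hb hug hi,
    base_change_mem_blockSet hb hc hvh (by rwa [hlen', ← hlen]), ?_, by omega, by omega⟩
  rw [hmul, hlen]
  exact base_change_mem_blockSet ha hc huw (by rwa [← hlen])

theorem trilinear_le_sum_tsum_blockMatrix (hφ : ∀ i, Function.Injective (φ i))
    (hρ : ∀ x, (ρ x : BaseCoset φ) = x) (i₀ : ι) {n : ℕ} {θ : PushoutI φ → ℝ≥0∞}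
    (hθ : ∀ k, θ k ≠ 0 → syllableLength φ k ≤ n) (ψ χ : PushoutI φ → ℝ≥0∞) :
    trilinear θ ψ χ ≤ ∑ r : Fin (2 * n + 1) × Fin (2 * n + 1),
      ∑' x : Σ i, (BaseCoset φ × BaseCoset φ × BaseCoset φ) × (K i × K i),
        blockMatrix i₀ ρ r.1 θ ⟨x.1, (x.2.1.1, x.2.1.2.1), x.2.2.1⟩ *
          blockMatrix i₀ ρ r.2 ψ ⟨x.1, (x.2.1.2.1, x.2.1.2.2), x.2.2.2⟩ *
          blockMatrix i₀ ρ r.1 χ ⟨x.1, (x.2.1.1, x.2.1.2.2), x.2.2.1 * x.2.2.2⟩ := by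
  rw [← tsum_fintype (L := .unconditional _), ← ENNReal.tsum_prod, trilinear]
  refine tsum_le_tsum_of_exists_lift (F := fun x : (Fin (2 * n + 1) × Fin (2 * n + 1)) ×
    (Σ i, (BaseCoset φ × BaseCoset φ × BaseCoset φ) × (K i × K i)) =>
    (blockProd ρ ⟨x.2.1, (x.2.2.1.1, x.2.2.1.2.1), x.2.2.2.1⟩,
      blockProd ρ ⟨x.2.1, (x.2.2.1.2.1, x.2.2.1.2.2), x.2.2.2.2⟩)) fun (y, z) hyz => ?_
  have hy := hθ y (left_ne_zero_of_mul (left_ne_zero_of_mul hyz))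
  obtain ⟨i, x₁, x₂, x₃, s, t, m, m', rfl, rfl, hs, ht, hst, hm, hm'⟩ :=
    exists_blockSet_triangle hφ hρ i₀ y z
  have hmul : blockProd ρ ⟨i, (x₁, x₃), s * t⟩ =
      blockProd ρ ⟨i, (x₁, x₂), s⟩ * blockProd ρ ⟨i, (x₂, x₃), t⟩ := by
    simp only [blockProd, map_mul, mul_assoc, inv_mul_cancel_left]
  refine ⟨((⟨m, by omega⟩, ⟨m', by omega⟩), ⟨i, (x₁, x₂, x₃), (s, t)⟩), rfl, le_of_eq ?_⟩
  simp only [blockMatrix, Set.indicator_of_mem hs, Set.indicator_of_mem ht,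
    Set.indicator_of_mem hst, hmul]

theorem TrilinearBound.wordLength [Nonempty ι] (hφ : ∀ i, Function.Injective (φ i))
    (hℓ : IsLetterLength φ ℓ₀ ℓ) (hℓ_ne : ∀ i, ∀ x ∉ (φ i).range, ℓ ⟨i, x⟩ ≠ 0) {n : ℕ} {c : ℝ≥0∞}
    (hc : ∀ i, TrilinearBound {x : K i | ℓ ⟨i, x⟩ ≤ 2 * n} c) :
    TrilinearBound {k : PushoutI φ | wordLength φ ℓ₀ ℓ k ≤ n} ((2 * n + 1) ^ 2 * c) := by
  intro θ ψ χ hθ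
  obtain ⟨ρ, hρ, hmin⟩ := exists_minimal_section (base φ).range (_root_.wordLength φ ℓ₀ ℓ)
  have hmin_base : ∀ x a, _root_.wordLength φ ℓ₀ ℓ (ρ x) ≤
      _root_.wordLength φ ℓ₀ ℓ (ρ x * base φ a) := fun x a => by
    have hx : ((ρ x * base φ a : PushoutI φ) : BaseCoset φ) = x := by
      rw [QuotientGroup.mk_mul_of_mem _ (MonoidHom.mem_range.2 ⟨a, rfl⟩), hρ]
    simpa only [hx] using hmin (ρ x * base φ a)
  let i₀ : ι := Classical.arbitrary ι
  have hletter : ∀ m i x s, blockMatrix i₀ ρ m θ ⟨i, x, s⟩ ≠ 0 → s ∈ {s | ℓ ⟨i, s⟩ ≤ 2 * n} := by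
    intro m i x s hne
    obtain ⟨⟨hblock, -⟩, hne⟩ := Set.indicator_apply_ne_zero.1 hne
    exact (hblock.letterLength_le hφ hℓ (hmin_base _) (hmin_base _)).trans
      (Nat.mul_le_mul_left 2 (hθ hne))
  calc trilinear θ ψ χ
      ≤ ∑ r : Fin (2 * n + 1) × Fin (2 * n + 1), _ :=
        trilinear_le_sum_tsum_blockMatrix hφ hρ i₀
          (fun k hk => (syllableLength_le_wordLength hℓ_ne k).trans (hθ hk)) ψ χ
    _ ≤ ∑ _ : Fin (2 * n + 1) × Fin (2 * n + 1),
          c * (ellTwoNorm θ * ellTwoNorm ψ * ellTwoNorm χ) := by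
        refine Finset.sum_le_sum fun r _ => ?_
        refine (TrilinearBound.tsum_triangle_le hc _ _ _ (hletter _)).trans ?_
        gcongr <;> exact ellTwoNorm_blockMatrix_le hφ hρ _ _
    _ = (2 * n + 1) ^ 2 * c * (ellTwoNorm θ * ellTwoNorm ψ * ellTwoNorm χ) := by
        simp [pow_two, mul_assoc]

end Blocks

section UniformDecay

variable {ι : Type*} {K : ι → Type*} [∀ i, Group (K i)]

/-- Rapid decay of every member of a family of groups, with a common polynomial. -/
def HasUniformRD (l : ∀ i, K i → ℝ) : Prop :=
  ∃ P : Polynomial ℝ, ∀ i, HasDecay (l i) fun n => P.eval (n : ℝ)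

/-- Subexponential decay of every member of a family of groups, with a common function. -/
def HasUniformSD (l : ∀ i, K i → ℝ) : Prop :=
  ∃ f : ℕ → ℝ, IsSubexponential f ∧ ∀ i, HasDecay (l i) f

theorem HasUniformRD.mono {l l' : ∀ i, K i → ℝ} (h : HasUniformRD l)
    (hl : ∀ i x, l i x ≤ l' i x) : HasUniformRD l' :=
  h.imp fun _ hP i => (hP i).mono (hl i) fun _ => le_rfl

theorem HasUniformSD.mono {l l' : ∀ i, K i → ℝ} (h : HasUniformSD l)
    (hl : ∀ i x, l i x ≤ l' i x) : HasUniformSD l' :=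
  h.imp fun _ hf => ⟨hf.1, fun i => (hf.2 i).mono (hl i) fun _ => le_rfl⟩

theorem HasUniformRD.of_finite [Finite ι] {l : ∀ i, K i → ℝ} (hl : ∀ i, l i 1 ≤ 0)
    (h : ∀ i, HasRD (l i)) : HasUniformRD l := by
  cases nonempty_fintype ι
  choose P hP using h
  refine ⟨∑ i, P i, fun i => (hP i).mono (fun _ => le_rfl) fun n => ?_⟩
  rw [Polynomial.eval_finsetSum]
  exact Finset.single_le_sum (f := fun i => (P i).eval (n : ℝ))
    (fun i _ => zero_le_one.trans ((hP i).one_le (hl i) n)) (Finset.mem_univ i)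

theorem isSubexponential_one : IsSubexponential fun _ => 1 :=
  ⟨fun _ => zero_le_one, by simp⟩

theorem IsSubexponential.max {f g : ℕ → ℝ} (hf : IsSubexponential f) (hg : IsSubexponential g) :
    IsSubexponential fun n => max (f n) (g n) := by
  refine ⟨fun n => (hf.1 n).trans (le_max_left _ _), ?_⟩
  have h := hf.2.max hg.2
  rw [max_self] at h
  exact h.congr fun n => ((Real.monotoneOn_rpow_Ici_of_exponent_nonneg
    (by positivity : (0 : ℝ) ≤ 1 / (n : ℝ))).map_max (hf.1 n) (hg.1 n)).symm

theorem exists_isSubexponential_forall_le [Finite ι] {F : ι → ℕ → ℝ}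
    (hF : ∀ i, IsSubexponential (F i)) : ∃ f, IsSubexponential f ∧ ∀ i n, F i n ≤ f n := by
  classical
  cases nonempty_fintype ι
  suffices h : ∀ s : Finset ι, ∃ f, IsSubexponential f ∧ ∀ i ∈ s, ∀ n, F i n ≤ f n by
    simpa using h Finset.univ
  intro s
  induction s using Finset.induction_on with
  | empty => exact ⟨_, isSubexponential_one, by simp⟩
  | insert i s _ ih =>
    obtain ⟨f, hf, hle⟩ := ih
    refine ⟨_, (hF i).max hf, fun j hj n => ?_⟩
    rcases Finset.mem_insert.1 hj with rfl | hj
    · exact le_max_left _ _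
    · exact (hle j hj n).trans (le_max_right _ _)

theorem HasUniformSD.of_finite [Finite ι] {l : ∀ i, K i → ℝ} (h : ∀ i, HasSD (l i)) :
    HasUniformSD l := by
  choose F hF hdecay using h
  obtain ⟨f, hf, hle⟩ := exists_isSubexponential_forall_le hF
  exact ⟨f, hf, fun i => (hdecay i).mono (fun _ => le_rfl) (hle i)⟩

theorem IsSubexponential.mul {f g : ℕ → ℝ} (hf : IsSubexponential f) (hg : IsSubexponential g) :
    IsSubexponential fun n => f n * g n := by
  refine ⟨fun n => mul_nonneg (hf.1 n) (hg.1 n), ?_⟩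
  have h := hf.2.mul hg.2
  rw [mul_one] at h
  exact h.congr fun n => (Real.mul_rpow (hf.1 n) (hg.1 n)).symm

theorem IsSubexponential.comp_const_mul {f : ℕ → ℝ} (hf : IsSubexponential f) {c : ℕ}
    (hc : 0 < c) : IsSubexponential fun n => f (c * n) := by
  refine ⟨fun n => hf.1 _, ?_⟩
  have h := (hf.2.comp (tendsto_id.const_mul_atTop' hc)).pow c
  rw [one_pow] at h
  refine h.congr fun n => ?_
  have hc' : (c : ℝ) ≠ 0 := Nat.cast_ne_zero.2 hc.ne'
  rw [Function.comp_apply, id_eq, ← Real.rpow_natCast, ← Real.rpow_mul (hf.1 _), Nat.cast_mul,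
    one_div, mul_inv_rev, inv_mul_cancel_right₀ hc', one_div]

theorem isSubexponential_natCast_add_one : IsSubexponential fun n => (n : ℝ) + 1 := by
  refine ⟨fun n => by positivity, ?_⟩
  have h := (tendsto_rpow_div_mul_add 1 1 (-1) zero_ne_one).comp
    (tendsto_atTop_add_const_right atTop (1 : ℝ) tendsto_natCast_atTop_atTop)
  refine h.congr fun n => ?_
  rw [Function.comp_apply, one_mul, add_neg_cancel_right]

end UniformDecay

section AmalgamDecay

variable {ι A : Type*} {K : ι → Type*} [∀ i, Group (K i)] [Group A] {φ : ∀ i, A →* K i}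
  {ℓ₀ : A → ℕ} {ℓ : (Σ i, K i) → ℕ}

theorem IsLetterLength.of_letter [Nonempty ι]
    (hℓ : ∀ i, IsLengthFunction fun x : K i => (ℓ ⟨i, x⟩ : ℝ))
    (hmap : ∀ i a, ℓ ⟨i, φ i a⟩ = ℓ₀ a) : IsLetterLength φ ℓ₀ ℓ where
  base := by
    let i : ι := Classical.arbitrary ι
    obtain ⟨hone, hinv, hmul⟩ := isLengthFunction_natCast_iff.1 (hℓ i)
    refine isLengthFunction_natCast_iff.2 ⟨?_, fun a => ?_, fun a b => ?_⟩
    · rw [← hmap i, map_one, hone]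
    · rw [← hmap i, map_inv, hinv, hmap]
    · simpa only [← hmap i, map_mul] using hmul (φ i a) (φ i b)
  letter := hℓ
  map_base := hmap

theorem HasDecay.wordLength [Nonempty ι] (hφ : ∀ i, Function.Injective (φ i))
    (hℓ : IsLetterLength φ ℓ₀ ℓ) (hℓ_ne : ∀ i, ∀ x ∉ (φ i).range, ℓ ⟨i, x⟩ ≠ 0) {f : ℕ → ℝ}
    (hf : ∀ i, HasDecay (fun x : K i => (ℓ ⟨i, x⟩ : ℝ)) f) :
    HasDecay (fun k => (wordLength φ ℓ₀ ℓ k : ℝ)) fun n => (2 * (n : ℝ) + 1) ^ 2 * f (2 * n) := by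
  intro n x hx
  have hone : 1 ≤ f (2 * n) :=
    (hf (Classical.arbitrary ι)).one_le (hℓ.letter _).map_one.le (2 * n)
  have hbound : ∀ i, TrilinearBound {x : K i | ℓ ⟨i, x⟩ ≤ 2 * n} (ENNReal.ofReal (f (2 * n))) :=
    fun i => ((hf i).trilinearBound (hℓ.letter i).map_one.le (2 * n)).mono
      fun g hg => show (ℓ ⟨i, g⟩ : ℝ) ≤ (2 * n : ℕ) from Nat.cast_le.2 hg
  have hconst : ENNReal.ofReal ((2 * (n : ℝ) + 1) ^ 2 * f (2 * n)) =
      (2 * n + 1) ^ 2 * ENNReal.ofReal (f (2 * n)) := by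
    rw [ENNReal.ofReal_mul (by positivity)]
    congr 1
    exact_mod_cast ENNReal.ofReal_natCast ((2 * n + 1) ^ 2)
  exact TrilinearBound.reducedNorm_le (hconst ▸ TrilinearBound.wordLength hφ hℓ hℓ_ne hbound)
    (by positivity) x fun g hg => Nat.cast_le.1 (hx g hg)

theorem HasUniformRD.wordLength [Nonempty ι] (hφ : ∀ i, Function.Injective (φ i))
    (hℓ : IsLetterLength φ ℓ₀ ℓ) (hℓ_ne : ∀ i, ∀ x ∉ (φ i).range, ℓ ⟨i, x⟩ ≠ 0)
    (h : HasUniformRD fun i (x : K i) => (ℓ ⟨i, x⟩ : ℝ)) :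
    HasRD fun k => (wordLength φ ℓ₀ ℓ k : ℝ) := by
  obtain ⟨P, hP⟩ := h
  refine ⟨(2 * Polynomial.X + 1) ^ 2 * P.comp (2 * Polynomial.X), ?_⟩
  simpa [Polynomial.eval_comp] using HasDecay.wordLength hφ hℓ hℓ_ne hP

theorem HasUniformSD.wordLength [Nonempty ι] (hφ : ∀ i, Function.Injective (φ i))
    (hℓ : IsLetterLength φ ℓ₀ ℓ) (hℓ_ne : ∀ i, ∀ x ∉ (φ i).range, ℓ ⟨i, x⟩ ≠ 0)
    (h : HasUniformSD fun i (x : K i) => (ℓ ⟨i, x⟩ : ℝ)) :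
    HasSD fun k => (wordLength φ ℓ₀ ℓ k : ℝ) := by
  obtain ⟨f, hf, hdecay⟩ := h
  refine ⟨_, ?_, HasDecay.wordLength hφ hℓ hℓ_ne hdecay⟩
  have hlin := isSubexponential_natCast_add_one.comp_const_mul two_pos
  simpa only [pow_two, Nat.cast_mul, Nat.cast_ofNat] using
    (hlin.mul hlin).mul (hf.comp_const_mul two_pos)

theorem IsLengthFunction.add {G : Type*} [Group G] {l l' : G → ℝ} (h : IsLengthFunction l)
    (h' : IsLengthFunction l') : IsLengthFunction fun g => l g + l' g where
  nonneg g := add_nonneg (h.nonneg g) (h'.nonneg g)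
  map_one := by rw [h.map_one, h'.map_one, add_zero]
  map_inv g := by rw [h.map_inv, h'.map_inv]
  map_mul_le g k := (add_le_add (h.map_mul_le g k) (h'.map_mul_le g k)).trans_eq
    (add_add_add_comm _ _ _ _)

theorem IsLengthFunction.natCeil {G : Type*} [Group G] {l : G → ℝ} (h : IsLengthFunction l) :
    IsLengthFunction fun g => (⌈l g⌉₊ : ℝ) :=
  isLengthFunction_natCast_iff.2 ⟨by rw [h.map_one, Nat.ceil_zero], fun g => by rw [h.map_inv],
    fun g k => (Nat.ceil_le_ceil (h.map_mul_le g k)).trans (Nat.ceil_add_le _ _)⟩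

theorem exists_natLength_ge (φ : ∀ i, A →* K i) {l₀ : A → ℝ} {l : ∀ i, K i → ℝ}
    (hl : ∀ i, IsLengthFunction (l i)) (hmap : ∀ i a, l i (φ i a) = l₀ a) :
    ∃ (ℓ₀ : A → ℕ) (ℓ : (Σ i, K i) → ℕ), (∀ i, IsLengthFunction fun x : K i => (ℓ ⟨i, x⟩ : ℝ)) ∧
      (∀ i a, ℓ ⟨i, φ i a⟩ = ℓ₀ a) ∧ (∀ i, ∀ x ∉ (φ i).range, ℓ ⟨i, x⟩ ≠ 0) ∧
      ∀ i x, l i x ≤ ℓ ⟨i, x⟩ := by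
  refine ⟨fun a => ⌈l₀ a⌉₊, fun s => ⌈l s.1 s.2⌉₊ + syllable φ s, fun i => ?_, fun i a => ?_,
    fun i x hx => ?_, fun i x => ?_⟩
  · simpa only [Nat.cast_add] using (hl i).natCeil.add (isLetterLength_syllable.letter i)
  · simp only [syllable_of_mem (MonoidHom.mem_range.2 ⟨a, rfl⟩), add_zero, hmap]
  · simp only [syllable_of_notMem hx]
    exact Nat.succ_ne_zero _
  · exact (Nat.le_ceil _).trans (Nat.cast_le.2 (Nat.le_add_right _ _))

theorem mainTheorem1_general [Nonempty ι] (φ : ∀ i, A →* K i)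
    (hφ : ∀ i, Function.Injective (φ i)) :
    (∀ (ℓ₀ : A → ℕ) (ℓ : (Σ i, K i) → ℕ), (∀ i, IsLengthFunction fun x : K i => (ℓ ⟨i, x⟩ : ℝ)) →
      (∀ i a, ℓ ⟨i, φ i a⟩ = ℓ₀ a) → (∀ i, ∀ x ∉ (φ i).range, ℓ ⟨i, x⟩ ≠ 0) →
      (IsLengthFunction fun k => (wordLength φ ℓ₀ ℓ k : ℝ)) ∧
      ((HasUniformRD fun i (x : K i) => (ℓ ⟨i, x⟩ : ℝ)) →
        HasRD fun k => (wordLength φ ℓ₀ ℓ k : ℝ)) ∧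
      ((HasUniformSD fun i (x : K i) => (ℓ ⟨i, x⟩ : ℝ)) →
        HasSD fun k => (wordLength φ ℓ₀ ℓ k : ℝ)) ∧
      ∀ f : ℕ → ℝ, (∀ i, HasDecay (fun x : K i => (ℓ ⟨i, x⟩ : ℝ)) f) →
        HasDecay (fun k => (wordLength φ ℓ₀ ℓ k : ℝ))
          fun n => (2 * (n : ℝ) + 1) ^ 2 * f (2 * n)) ∧
    ∀ (l₀ : A → ℝ) (l : ∀ i, K i → ℝ), (∀ i, IsLengthFunction (l i)) →
      (∀ i a, l i (φ i a) = l₀ a) →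
      (HasUniformRD l → ∃ L : PushoutI φ → ℝ, IsLengthFunction L ∧ HasRD L) ∧
      (HasUniformSD l → ∃ L : PushoutI φ → ℝ, IsLengthFunction L ∧ HasSD L) := by
  constructor
  · intro ℓ₀ ℓ hlen hmap hne
    have hℓ := IsLetterLength.of_letter hlen hmap
    exact ⟨isLengthFunction_wordLength hℓ, HasUniformRD.wordLength hφ hℓ hne,
      HasUniformSD.wordLength hφ hℓ hne, fun f => HasDecay.wordLength hφ hℓ hne⟩
  · intro l₀ l hl hmap
    obtain ⟨ℓ₀, ℓ, hlen, hmap', hne, hle⟩ := exists_natLength_ge φ hl hmap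
    have hℓ := IsLetterLength.of_letter hlen hmap'
    have hL := isLengthFunction_wordLength hℓ
    exact ⟨fun h => ⟨_, hL, HasUniformRD.wordLength hφ hℓ hne (h.mono hle)⟩,
      fun h => ⟨_, hL, HasUniformSD.wordLength hφ hℓ hne (h.mono hle)⟩⟩

end AmalgamDecay

theorem sq_le_rpow_seven_halves (n : ℕ) :
    (2 * (n : ℝ) + 1) ^ 2 ≤ (2 * (n : ℝ) + 1) ^ (7 / 2 : ℝ) := by
  rw [← Real.rpow_natCast]
  exact Real.rpow_le_rpow_of_exponent_le (by linarith [n.cast_nonneg (α := ℝ)]) (by norm_num)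

theorem mainTheorem1 {A : Type v} {G H : Type u} [Group A] [Group G] [Group H]
    (i : A →* G) (j : A →* H) (hi : Function.Injective i) (hj : Function.Injective j) :
    -- integer-valued lengths, nonzero off `A`: decay with respect to the explicit length
    (∀ (LG : G → ℕ) (LH : H → ℕ),
      IsLengthFunction (fun g => (LG g : ℝ)) → IsLengthFunction (fun h => (LH h : ℝ)) →
      (∀ a, LG (i a) = LH (j a)) →
      (∀ g, g ∉ i.range → LG g ≠ 0) → (∀ h, h ∉ j.range → LH h ≠ 0) →
      IsLengthFunction (fun k => (amalgamLength i j LG LH k : ℝ)) ∧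
      (HasRD (fun g => (LG g : ℝ)) → HasRD (fun h => (LH h : ℝ)) →
        HasRD (fun k => (amalgamLength i j LG LH k : ℝ))) ∧
      (HasSD (fun g => (LG g : ℝ)) → HasSD (fun h => (LH h : ℝ)) →
        HasSD (fun k => (amalgamLength i j LG LH k : ℝ))) ∧
      (∀ f : ℕ → ℝ, HasDecay (fun g => (LG g : ℝ)) f → HasDecay (fun h => (LH h : ℝ)) f →
        HasDecay (fun k => (amalgamLength i j LG LH k : ℝ))
          (fun n => (2 * (n : ℝ) + 1) ^ (7 / 2 : ℝ) * f (2 * n)))) ∧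
    -- arbitrary real-valued lengths: decay with respect to some length
    (∀ (LG : G → ℝ) (LH : H → ℝ), IsLengthFunction LG → IsLengthFunction LH →
      (∀ a, LG (i a) = LH (j a)) →
      (HasRD LG → HasRD LH →
        ∃ L : Amalgam i j → ℝ, IsLengthFunction L ∧ HasRD L) ∧
      (HasSD LG → HasSD LH →
        ∃ L : Amalgam i j → ℝ, IsLengthFunction L ∧ HasSD L)) := by
  have hφ : ∀ b, Function.Injective (factorMap i j b) := Bool.forall_bool.2 ⟨hi, hj⟩
  obtain ⟨hnat, hreal⟩ := mainTheorem1_general (factorMap i j) hφ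
  constructor
  · intro LG LH hG hH hA hG_ne hH_ne
    have hlen : ∀ b, IsLengthFunction fun x => (letterLength LG LH ⟨b, x⟩ : ℝ) :=
      Bool.forall_bool.2 ⟨hG, hH⟩
    obtain ⟨hL, hRD, hSD, hdecay⟩ := hnat (fun a => LG (i a)) (letterLength LG LH) hlen
      (Bool.forall_bool.2 ⟨fun _ => rfl, fun a => (hA a).symm⟩) (Bool.forall_bool.2 ⟨hG_ne, hH_ne⟩)
    refine ⟨hL, fun h h' => hRD ?_, fun h h' => hSD ?_, fun f h h' => ?_⟩
    · exact .of_finite (fun b => (hlen b).map_one.le) (Bool.forall_bool.2 ⟨h, h'⟩)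
    · exact .of_finite (Bool.forall_bool.2 ⟨h, h'⟩)
    · refine (hdecay f (Bool.forall_bool.2 ⟨h, h'⟩)).mono (fun _ => le_rfl) fun n => ?_
      exact mul_le_mul_of_nonneg_right (sq_le_rpow_seven_halves n)
        (zero_le_one.trans (h.one_le hG.map_one.le (2 * n)))
  · intro LG LH hG hH hA
    let l : ∀ b, Factor G H b → ℝ := Bool.rec LG LH
    have hlen : ∀ b, IsLengthFunction (l b) := Bool.forall_bool.2 ⟨hG, hH⟩
    obtain ⟨hRD, hSD⟩ := hreal (fun a => LG (i a)) l hlen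
      (Bool.forall_bool.2 ⟨fun _ => rfl, fun a => (hA a).symm⟩)
    exact ⟨fun h h' => hRD (.of_finite (fun b => (hlen b).map_one.le)
      (Bool.forall_bool.2 ⟨h, h'⟩)), fun h h' => hSD (.of_finite (Bool.forall_bool.2 ⟨h, h'⟩))⟩
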